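/- **Setting.** Let $(\mathcal Y_i)_{i\in I}$ and $(\mathcal Z_j)_{j\in J}$ be finite families of real Hilbert spaces, and set $\mathcal Y=\prod_{i\in I}\mathcal Y_i$ and $\mathcal Z=\prod_{j\in J}\mathcal Z_j$ (Hilbert direct sums). For all $i\in I$, $j\in J$, let $A_i\colon\mathcal Y_i\to2^{\mathcal Y_i}$ and $B_j\colon\mathcal Z_j\to2^{\mathcal Z_j}$ be maximally monotone, let $C_i\colon\mathcal Y_i\to\mathcal Y_i$ be monotone and $\mu_i$-Lipschitzian, let $D_j\colon\mathcal Z_j\to\mathcal Z_j$ be monotone and $\nu_j$-Lipschitzian, with $\mu_i,\nu_j\in(0,\infty)$, let $L_{ji}\colon\mathcal Y_i\to\mathcal Z_j$ be linear and bounded, and let $s_i^*\in\mathcal Y_i$, $r_j\in\mathcal Z_j$. Let $\mathscr P$ be the set of $(x_i)_{i}\in\mathcal Y$ such that, for every $i\in I$, $$s_i^*\in A_ix_i+\sum_{j\in J}L_{ji}^*\Big((B_j+D_j)\Big(\sum_{k\in I}L_{jk}x_k-r_j\Big)\Big)+C_ix_i .$$ Let $\mathscr D$ be the set of $(v_j^*)_j\in\mathcal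 Z$ for which there is $(x_i)_i\in\mathcal Y$ such that $s_i^*-\sum_{k\in J}L_{ki}^*v_k^*\in A_ix_i+C_ix_i$ for every $i\in I$ and $v_j^*\in(B_j+D_j)\big(\sum_{k\in I}L_{jk}x_k-r_j\big)$ for every $j\in J$. Let $Z$ be the set of $\big((x_i)_i,(v_j^*)_j\big)\in\mathcal Y\times\mathcal Z$ such that $$s_i^*-\sum_{k\in J}L_{ki}^*v_k^*\in A_ix_i+C_ix_i\ \ (\forall i\in I)\quad\text{and}\quad \sum_{k\in I}L_{jk}x_k-r_j\in(B_j+D_j)^{-1}v_j^*\ \ (\forall j\in J),$$ and suppose that $Z\neq\varnothing$. **Parameters.** For all $i\in I$, $j\in J$, let $\alpha_i,\chi_i,\beta_j,\kappa_j\in(0,\infty)$, $\varepsilon_i\in(0,\alpha_i/(\mu_i+1))$, $\delta_j\in(0,\beta_j/(\nu_j+1))$. For every $n\in\mathbb N$, let $F_{i,n}\colon\mathcal Y_i\to\mathcal Y_i$ be $\alpha_i$-strongly monotone and $\chi_i$-Lipschitzian, let $W_{j,n}\colon\mathcal Z_j\to\mathcal Z_j$ be $\beta_j$-strongly monotone and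 $\kappa_j$-Lipschitzian, and let $$\gamma_{i,n}\in[\varepsilon_i,(\alpha_i-\varepsilon_i)/\mu_i],\qquad \tau_{j,n}\in[\delta_j,(\beta_j-\delta_j)/\nu_j].$$ Let $(\lambda_n)_{n\in\mathbb N}$ be a sequence in $(0,2)$ with $0<\inf_n\lambda_n\le\sup_n\lambda_n<2$. **Algorithm.** Given $(x_{i,0})_i\in\mathcal Y$, $(y_{j,0})_j,(v^*_{j,0})_j\in\mathcal Z$, and, for every $n$, evaluation points $(\widetilde x_{i,n})_i\in\mathcal Y$ and $(\widetilde y_{j,n})_j,(\widetilde v^*_{j,n})_j\in\mathcal Z$, compute for $n=0,1,\dots$, for all $i\in I$ and $j\in J$, $$\begin{aligned} l_{i,n}^*&=F_{i,n}\widetilde x_{i,n}-\gamma_{i,n}C_i\widetilde x_{i,n}-\gamma_{i,n}\textstyle\sum_{j\in J}L_{ji}^*\widetilde v_{j,n}^*,\\ a_{i,n}&=(F_{i,n}+\gamma_{i,n}A_i)^{-1}(l_{i,n}^*+\gamma_{i,n}s_i^*),\\ o_{i,n}^*&=\gamma_{i,n}^{-1}(l_{i,n}^*-F_{i,n}a_{i,n})+C_ia_{i,n},\\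 t_{j,n}^*&=W_{j,n}\widetilde y_{j,n}-\tau_{j,n}D_j\widetilde y_{j,n}+\tau_{j,n}\widetilde v_{j,n}^*,\\ b_{j,n}&=(W_{j,n}+\tau_{j,n}B_j)^{-1}t_{j,n}^*,\\ f_{j,n}^*&=\tau_{j,n}^{-1}(t_{j,n}^*-W_{j,n}b_{j,n})+D_jb_{j,n},\\ c_{j,n}&=\textstyle\sum_{i\in I}L_{ji}\widetilde x_{i,n}-\widetilde y_{j,n}+\widetilde v_{j,n}^*-r_j,\\ a_{i,n}^*&=o_{i,n}^*+\textstyle\sum_{j\in J}L_{ji}^*c_{j,n},\qquad b_{j,n}^*=f_{j,n}^*-c_{j,n},\qquad c_{j,n}^*=r_j+b_{j,n}-\textstyle\sum_{i\in I}L_{ji}a_{i,n},\\ \sigma_n&=\textstyle\sum_{i\in I}\|a_{i,n}^*\|^2+\sum_{j\in J}\big(\|b_{j,n}^*\|^2+\|c_{j,n}^*\|^2\big),\\ \theta_n&=\textstyle\sum_{i\in I}\langle a_{i,n}-x_{i,n},a_{i,n}^*\rangle+\sum_{j\in J}\big(\langle b_{j,n}-y_{j,n},b_{j,n}^*\rangle+\langle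 c_{j,n}-v_{j,n}^*,c_{j,n}^*\rangle\big),\\ \rho_n&=\lambda_n\theta_n/\sigma_n\ \text{ if }\theta_n<0,\qquad \rho_n=0\ \text{ otherwise},\\ x_{i,n+1}&=x_{i,n}+\rho_na_{i,n}^*,\qquad y_{j,n+1}=y_{j,n}+\rho_nb_{j,n}^*,\qquad v_{j,n+1}^*=v_{j,n}^*+\rho_nc_{j,n}^*. \end{aligned}$$ **Claim.** The inverses $(F_{i,n}+\gamma_{i,n}A_i)^{-1}$ and $(W_{j,n}+\tau_{j,n}B_j)^{-1}$ are single-valued and defined everywhere, so that the algorithm is well defined. Moreover, if $\widetilde x_{i,n}-x_{i,n}\to0$, $\widetilde y_{j,n}-y_{j,n}\to0$ and $\widetilde v_{j,n}^*-v_{j,n}^*\to0$ (in norm, as $n\to\infty$) for all $i\in I$ and $j\in J$, then there are $\overline x\in\mathscr P$ and $\overline v^*\in\mathscr D$ such that $(x_{i,n})_{i\in I}$ converges weakly to $\overline x$ in $\mathcal Y$, $(v_{j,n}^*)_{j\in J}$ converges weakly to $\overline v^*$ in $\mathcal Z$, and $(\overline x,\overline v^*)\in Z$. -/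

import Mathlib

open Filter Topology
open scoped Pointwise NNReal InnerProduct

namespace SetValued

variable {H : Type*} [NormedAddCommGroup H] [InnerProductSpace ℝ H]

/-- A single-valued operator, seen as a set-valued one. -/
def single (T : H → H) : H → Set H := fun x => {T x}

/-- The sum `M + N` of two set-valued operators (Minkowski sum of the values). -/
def add (M N : H → Set H) : H → Set H := fun x => M x + N x

/-- The multiple `γ M` of a set-valued operator. -/
def smul (γ : ℝ) (M : H → Set H) : H → Set H := fun x => γ • M x

/-- The inverse of a set-valued operator: `x ∈ M⁻¹ u` if and only if `u ∈ M x`. -/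
def inv (M : H → Set H) : H → Set H := fun u => {x | u ∈ M x}

/-- `M` is monotone. -/
def IsMonotone (M : H → Set H) : Prop :=
  ∀ ⦃x u y v : H⦄, u ∈ M x → v ∈ M y → 0 ≤ inner ℝ (x - y) (u - v)

/-- `M` is maximally monotone: it is monotone and no monotone operator has a strictly larger
graph. -/
def IsMaximallyMonotone (M : H → Set H) : Prop :=
  IsMonotone M ∧ ∀ N : H → Set H, IsMonotone N → (∀ x, M x ⊆ N x) → N = M

/-- `M` is strongly monotone with constant `α`. -/
def IsStronglyMonotone (α : ℝ) (M : H → Set H) : Prop :=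
  ∀ ⦃x u y v : H⦄, u ∈ M x → v ∈ M y → α * ‖x - y‖ ^ 2 ≤ inner ℝ (x - y) (u - v)

end SetValued

/-- Weak convergence of a sequence in a real Hilbert space. -/
def WeaklyConverges {H : Type*} [NormedAddCommGroup H] [InnerProductSpace ℝ H]
    (x : ℕ → H) (p : H) : Prop :=
  Tendsto (fun n => toWeakSpace ℝ H (x n)) atTop (𝓝 (toWeakSpace ℝ H p))

namespace CoupledSystem

open SetValued

variable {I J : Type*} [Fintype I] [Fintype J] {Y : I → Type*} {Z : J → Type*}
  [∀ i, NormedAddCommGroup (Y i)] [∀ i, InnerProductSpace ℝ (Y i)] [∀ i, CompleteSpace (Y i)]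
  [∀ j, NormedAddCommGroup (Z j)] [∀ j, InnerProductSpace ℝ (Z j)] [∀ j, CompleteSpace (Z j)]

/-- Solutions `(x i)` of the primal system: for every `i`,
`s i ∈ A i (x i) + ∑ j, L j i* ((B j + D j) (∑ k, L j k (x k) - r j)) + C i (x i)`. -/
def primalSolutions (A : ∀ i, Y i → Set (Y i)) (B : ∀ j, Z j → Set (Z j))
    (C : ∀ i, Y i → Y i) (D : ∀ j, Z j → Z j) (L : ∀ j i, Y i →L[ℝ] Z j)
    (s : ∀ i, Y i) (r : ∀ j, Z j) : Set (PiLp 2 Y) :=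
  {x | ∀ i, s i ∈ A i (x i)
      + ∑ j, (ContinuousLinearMap.adjoint (L j i)) ''
          add (B j) (single (D j)) (∑ k, L j k (x k) - r j)
      + {C i (x i)}}

/-- Solutions `(v j)` of the dual problem: for some `(x i)`,
`s i - ∑ k, L k i* (v k) ∈ A i (x i) + C i (x i)` for every `i`, and
`v j ∈ (B j + D j) (∑ k, L j k (x k) - r j)` for every `j`. -/
def dualSolutions (A : ∀ i, Y i → Set (Y i)) (B : ∀ j, Z j → Set (Z j))
    (C : ∀ i, Y i → Y i) (D : ∀ j, Z j → Z j) (L : ∀ j i, Y i →L[ℝ] Z j)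
    (s : ∀ i, Y i) (r : ∀ j, Z j) : Set (PiLp 2 Z) :=
  {v | ∃ x : PiLp 2 Y,
      (∀ i, s i - ∑ k, ContinuousLinearMap.adjoint (L k i) (v k)
        ∈ add (A i) (single (C i)) (x i)) ∧
      ∀ j, v j ∈ add (B j) (single (D j)) (∑ k, L j k (x k) - r j)}

/-- The Kuhn–Tucker set of the system. -/
def kuhnTucker (A : ∀ i, Y i → Set (Y i)) (B : ∀ j, Z j → Set (Z j))
    (C : ∀ i, Y i → Y i) (D : ∀ j, Z j → Z j) (L : ∀ j i, Y i →L[ℝ] Z j)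
    (s : ∀ i, Y i) (r : ∀ j, Z j) : Set (PiLp 2 Y × PiLp 2 Z) :=
  {p | (∀ i, s i - ∑ k, ContinuousLinearMap.adjoint (L k i) (p.2 k)
          ∈ add (A i) (single (C i)) (p.1 i)) ∧
       ∀ j, ∑ k, L j k (p.1 k) - r j ∈ inv (add (B j) (single (D j))) (p.2 j)}

end CoupledSystem

/-! ### Weak compactness in Hilbert spaces and a finite minimax lemma. -/

section HilbertTheory

variable {H : Type*} [NormedAddCommGroup H] [InnerProductSpace ℝ H]

/-! Stacking the coordinates turns the system into a single composite inclusion `0 ∈ M x + L* N (L x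
- r)`. With the extra variables `y = L x - r` and the dual `v`, this becomes the search for a zero
of the operator `saddle`: a maximally monotone product plus a skew linear map and a constant. Its
zeros are the Kuhn–Tucker pairs, with `y` determined by `x`.

Each iteration yields a point `p n` and an element `u n` of the saddle operator at `p n`. By
monotonicity the half-space `⟪z - p n, u n⟫ ≤ 0` contains every zero, and the update is a relaxed
projection onto it. The iterates are therefore Fejér monotone and their distances to these
half-spaces tend to 0. Moreover `u n` is the increment, from `p n` to the evaluation point, of the
kernel with blocks `γ⁻¹F - C`, `τ⁻¹W - D` and `Id`, minus the skew part. This kernel is Lipschitz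
and strongly monotone uniformly in `n`, so `p n` approaches the iterates and `u n → 0`. Weak-strong
closedness of the graph makes every weak cluster point a zero, and Opial's lemma concludes
(`exists_weak_limit_of_separating_projections`).

Well-posedness and the maximality of all the operators built here rest on Minty's theorem,
`exists_resolvent`, obtained from a finite minimax argument and weak compactness. A contraction
argument then replaces the identity by a kernel `F`. -/

/-- A bounded family in a Hilbert space converges weakly along every ultrafilter. -/
theorem Ultrafilter.exists_weak_limit [CompleteSpace H] {ι : Type*} (U : Ultrafilter ι)
    (x : ι → H) (R : ℝ) (hR : ∀ᶠ i in (U : Filter ι), ‖x i‖ ≤ R) :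
    ∃ p : H, ∀ w, Tendsto (fun i => inner ℝ (x i) w) U (𝓝 (inner ℝ p w)) := by
  -- Riesz representation moves the family to the dual, where Banach–Alaoglu applies.
  let φ : ι → WeakDual ℝ H := fun i => StrongDual.toWeakDual (InnerProductSpace.toDual ℝ H (x i))
  have hK := WeakDual.isCompact_closedBall (𝕜 := ℝ) (E := H) 0 R
  obtain ⟨f, -, hf⟩ := hK.ultrafilter_le_nhds (U.map φ) (by
    rw [le_principal_iff, Ultrafilter.coe_map, Filter.mem_map]
    filter_upwards [hR] with i hi
    simpa [φ] using hi)
  refine ⟨(InnerProductSpace.toDual ℝ H).symm (WeakDual.toStrongDual f), fun w => ?_⟩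
  have h : Tendsto φ U (𝓝 f) := hf
  have h2 := ((WeakDual.eval_continuous w).tendsto f).comp h
  rw [InnerProductSpace.toDual_symm_apply]
  exact h2

/-- Weak limits along a filter satisfy the norm bound in quadratic form: a closed ball is weakly
closed. -/
theorem norm_sq_add_inner_le_of_weak_limit {ι : Type*} {l : Filter ι} [l.NeBot] {x : ι → H} {p : H}
    (hp : ∀ w, Tendsto (fun i => inner ℝ (x i) w) l (𝓝 (inner ℝ p w))) (w : H) (q : ℝ)
    (h : ∀ᶠ i in l, ‖x i‖ ^ 2 + inner ℝ (x i) w ≤ q) : ‖p‖ ^ 2 + inner ℝ p w ≤ q := by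
  -- The squared norm is replaced by its affine minorant at `p`, which passes to the weak limit.
  have h1 : Tendsto (fun i => 2 * inner ℝ (x i) p - ‖p‖ ^ 2 + inner ℝ (x i) w) l
      (𝓝 (2 * inner ℝ p p - ‖p‖ ^ 2 + inner ℝ p w)) :=
    (((hp p).const_mul 2).sub_const _).add (hp w)
  have h2 := le_of_tendsto h1 (b := q) (by
    filter_upwards [h] with i hi
    have := sq_nonneg ‖x i - p‖
    rw [@norm_sub_sq_real] at this
    linarith)
  rw [real_inner_self_eq_norm_sq] at h2
  linarith

/-- A finite monotone family has a point in the intersection of the balls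
`⟪p - x i, p + u i⟫ ≤ 0`: it is given by the maximizer of a concave quadratic on the simplex. -/
theorem exists_forall_inner_nonpos_of_monotone_family {ι : Type*} [Fintype ι] (x u : ι → H)
    (h : ∀ i j, 0 ≤ inner ℝ (x i - x j) (u i - u j)) :
    ∃ p : H, ∀ i, inner ℝ (p - x i) (p + u i) ≤ 0 := by
  classical
  rcases isEmpty_or_nonempty ι with hι | hι
  · exact ⟨0, fun i => (IsEmpty.false i).elim⟩
  -- For weights `w`, the `w`-average of `⟪p - x i, p + u i⟫` is `‖p‖² - ⟪p, P w⟫ - Q w`. Its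
  -- minimum over `p`, attained at `P w / 2`, is the function maximized below: this is Lagrangian
  -- duality for minimizing the largest of these inner products.
  let P : (ι → ℝ) → H := fun w => ∑ i, w i • (x i - u i)
  let Q : (ι → ℝ) → ℝ := fun w => ∑ i, w i * inner ℝ (x i) (u i)
  have hcont : Continuous fun w : ι → ℝ => -(‖P w‖ ^ 2 / 4) - Q w := by
    simp only [P, Q]; fun_prop
  obtain ⟨w, hw, hmax⟩ := (isCompact_stdSimplex ℝ ι).exists_isMaxOn
    ⟨_, single_mem_stdSimplex ℝ (Classical.arbitrary ι)⟩ hcont.continuousOn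
  have hopt : ∀ j, ‖P w‖ ^ 2 / 2 + Q w ≤ inner ℝ (P w) (x j - u j) / 2 + inner ℝ (x j) (u j) := by
    intro j
    by_contra! hlt
    set d := x j - u j - P w with hd
    set gap := ‖P w‖ ^ 2 / 2 + Q w - (inner ℝ (P w) (x j - u j) / 2 + inner ℝ (x j) (u j)) with hgap
    have hgap0 : 0 < gap := by rw [hgap]; linarith
    -- Moving from `w` towards vertex `j` gains `t * gap` to first order and loses only `t ^ 2 * ‖d‖
    -- ^ 2 / 4`; a small `t` contradicts maximality.
    have key : ∀ t : ℝ, 0 ≤ t → t ≤ 1 → t * gap ≤ t ^ 2 * ‖d‖ ^ 2 / 4 := by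
      intro t h0 h1
      have hmem : (1 - t) • w + t • Pi.single j 1 ∈ stdSimplex ℝ ι :=
        convex_stdSimplex ℝ ι hw (single_mem_stdSimplex ℝ j) (by linarith) h0 (by ring)
      have hle := hmax hmem
      have hP : P ((1 - t) • w + t • Pi.single j 1) = P w + t • d := by
        simp only [P, Pi.add_apply, Pi.smul_apply, smul_eq_mul, add_smul, mul_smul,
          Finset.sum_add_distrib, ← Finset.smul_sum, hd]
        have : ∑ i, (Pi.single j (1 : ℝ) : ι → ℝ) i • (x i - u i) = x j - u j := by
          simp [Pi.single_apply, ite_smul]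
        rw [this]
        module
      have hQ : Q ((1 - t) • w + t • Pi.single j 1)
          = Q w + t * (inner ℝ (x j) (u j) - Q w) := by
        simp only [Q, Pi.add_apply, Pi.smul_apply, smul_eq_mul, add_mul, mul_assoc,
          Finset.sum_add_distrib, ← Finset.mul_sum]
        have : ∑ i, (Pi.single j (1 : ℝ) : ι → ℝ) i * inner ℝ (x i) (u i) = inner ℝ (x j) (u j) := by
          simp [Pi.single_apply]
        rw [this]
        ring
      simp only [Set.mem_ofPred_eq] at hle
      rw [hP, hQ, norm_add_sq_real, inner_smul_right, norm_smul, mul_pow, Real.norm_eq_abs,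
        sq_abs] at hle
      have hin : inner ℝ (P w) d = inner ℝ (P w) (x j - u j) - ‖P w‖ ^ 2 := by
        rw [hd, inner_sub_right, real_inner_self_eq_norm_sq]
      rw [hin] at hle
      rw [hgap]
      nlinarith
    have hD : 0 < gap + ‖d‖ ^ 2 := by positivity
    have := key (gap / (gap + ‖d‖ ^ 2)) (by positivity)
      ((div_le_one hD).2 (by linarith [sq_nonneg ‖d‖]))
    have h3 : gap * gap * (gap + ‖d‖ ^ 2) ≤ gap ^ 2 * ‖d‖ ^ 2 / 4 := by
      field_simp at this
      nlinarith
    have h4 : 0 < gap ^ 3 := by positivity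
    nlinarith [mul_nonneg (sq_nonneg gap) (sq_nonneg ‖d‖)]
  have hsum : ∑ i, w i = 1 := hw.2
  set X := ∑ i, w i • x i with hX
  set V := ∑ i, w i • u i with hV
  have hPw : P w = X - V := by
    simp only [P, smul_sub, Finset.sum_sub_distrib, hX, hV]
  -- The doubly averaged monotonicity inequality expands to `2 * (Q w - ⟪X, V⟫) ≥ 0`.
  have hmono : inner ℝ X V ≤ Q w := by
    have h0 : 0 ≤ ∑ i, ∑ j, w i * (w j * inner ℝ (x i - x j) (u i - u j)) :=
      Finset.sum_nonneg fun i _ => Finset.sum_nonneg fun j _ =>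
        mul_nonneg (hw.1 i) (mul_nonneg (hw.1 j) (h i j))
    have h1 : ∀ i, ∑ j, w i * (w j * inner ℝ (x i - x j) (u i - u j))
        = w i * inner ℝ (x i) (u i) - w i * inner ℝ (x i) V - w i * inner ℝ X (u i)
          + w i * Q w := by
      intro i
      rw [← Finset.mul_sum]
      have : ∑ j, w j * inner ℝ (x i - x j) (u i - u j)
          = inner ℝ (x i) (u i) - inner ℝ (x i) V - inner ℝ X (u i) + Q w := by
        simp only [inner_sub_left, inner_sub_right, mul_sub, Finset.sum_sub_distrib,
          ← Finset.sum_mul, hsum, one_mul, hX, hV, Q, inner_sum, sum_inner, inner_smul_left,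
          inner_smul_right, RCLike.conj_to_real]
        ring
      rw [this]; ring
    have h2 : ∑ i, ∑ j, w i * (w j * inner ℝ (x i - x j) (u i - u j))
        = Q w - inner ℝ X V - inner ℝ X V + Q w := by
      simp only [h1, Finset.sum_add_distrib, Finset.sum_sub_distrib, ← Finset.sum_mul, hsum,
        one_mul]
      congr 2
      · congr 1
        simp only [hX, sum_inner, inner_smul_left, RCLike.conj_to_real]
      · simp only [hV, inner_sum, inner_smul_right]
    linarith
  refine ⟨(1 / 2 : ℝ) • P w, fun j => ?_⟩
  have e : inner ℝ ((1 / 2 : ℝ) • P w - x j) ((1 / 2 : ℝ) • P w + u j)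
      = ‖P w‖ ^ 2 / 4 - inner ℝ (P w) (x j - u j) / 2 - inner ℝ (x j) (u j) := by
    simp only [inner_sub_left, inner_add_right, inner_sub_right, inner_smul_left,
      inner_smul_right, RCLike.conj_to_real, real_inner_self_eq_norm_sq,
      real_inner_comm (P w) (x j)]
    ring
  have e2 : ‖P w‖ ^ 2 = ‖X + V‖ ^ 2 - 4 * inner ℝ X V := by
    rw [hPw, norm_sub_sq_real, norm_add_sq_real]; ring
  rw [e]
  have := hopt j
  nlinarith [sq_nonneg ‖X + V‖]

end HilbertTheory

/-! ### Maximally monotone operators, Minty's theorem and warped resolvents. -/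

namespace SetValued

variable {H : Type*} [NormedAddCommGroup H] [InnerProductSpace ℝ H]

/-- Adjoining the pair `(x, u)` to the graph keeps it monotone, so maximality says that the pair was
already there. -/
theorem IsMaximallyMonotone.mem_of_forall {M : H → Set H} (hM : IsMaximallyMonotone M) {x u : H}
    (h : ∀ y v, v ∈ M y → 0 ≤ inner ℝ (x - y) (u - v)) : u ∈ M x := by
  have := hM.2 (fun y => M y ∪ {v | y = x ∧ v = u}) ?_ fun y => Set.subset_union_left
  · rw [← this]
    exact Or.inr ⟨rfl, rfl⟩
  · rintro y v z w (hv | ⟨rfl, rfl⟩) (hw | ⟨rfl, rfl⟩)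
    · exact hM.1 hv hw
    · have := h _ _ hv
      rwa [← neg_sub z, ← neg_sub w, inner_neg_neg]
    · exact h _ _ hw
    · simp

/-- A monotone operator `M` such that `Id + M` is surjective is maximally monotone. -/
theorem IsMonotone.isMaximallyMonotone {M : H → Set H} (hM : IsMonotone M)
    (h : ∀ z, ∃ p, z - p ∈ M p) : IsMaximallyMonotone M := by
  refine ⟨hM, fun N hN hMN => ?_⟩
  funext x
  refine Set.Subset.antisymm (fun u hu => ?_) (hMN x)
  -- The pairs `(x, u)` and `(p, x + u - p)` have the same sum, so monotonicity of `N` reads `-‖x -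
  -- p‖² ≥ 0`.
  obtain ⟨p, hp⟩ := h (x + u)
  have h1 := hN hu (hMN _ hp)
  have h2 : u - (x + u - p) = -(x - p) := by abel
  rw [h2, inner_neg_right, real_inner_self_eq_norm_sq] at h1
  have h3 : ‖x - p‖ = 0 := by
    have := norm_nonneg (x - p)
    nlinarith
  obtain rfl : x = p := sub_eq_zero.1 (norm_eq_zero.1 h3)
  simpa using hp

variable [CompleteSpace H]

/-- **Minty's theorem**: the resolvents of a maximally monotone operator are defined everywhere. -/
theorem IsMaximallyMonotone.exists_resolvent {M : H → Set H} (hM : IsMaximallyMonotone M) {t : ℝ}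
    (ht : 0 < t) (z : H) : ∃ p, t⁻¹ • (z - p) ∈ M p := by
  classical
  let G := {g : H × H // g.2 ∈ M g.1}
  -- Each condition confines `p` to a closed ball; it remains to show that all these balls meet.
  suffices hp : ∃ p : H, ∀ g : G, inner ℝ (p - g.1.1) (p + (t • g.1.2 - z)) ≤ 0 by
    obtain ⟨p, hp⟩ := hp
    refine ⟨p, hM.mem_of_forall fun y v hv => ?_⟩
    have h1 := hp ⟨(y, v), hv⟩
    have h2 : t⁻¹ • (z - p) - v = -(t⁻¹ • (p + (t • v - z))) := by
      rw [smul_add, smul_sub, smul_sub, smul_smul, inv_mul_cancel₀ ht.ne', one_smul]; abel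
    rw [h2, inner_neg_right, inner_smul_right]
    have := mul_nonpos_of_nonneg_of_nonpos (inv_pos.2 ht).le h1
    simpa using this
  rcases isEmpty_or_nonempty G with hG | ⟨⟨g₀⟩⟩
  · exact ⟨0, fun g => (hG.false g).elim⟩
  have hfin : ∀ S : Finset G, ∃ p : H, ∀ g ∈ S,
      inner ℝ (p - g.1.1) (p + (t • g.1.2 - z)) ≤ 0 := by
    intro S
    obtain ⟨p, hp⟩ := exists_forall_inner_nonpos_of_monotone_family (ι := S)
      (fun g => g.1.1.1) (fun g => t • g.1.1.2 - z) (fun g k => by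
        have := hM.1 g.1.2 k.1.2
        rw [sub_sub_sub_cancel_right, ← smul_sub, inner_smul_right]
        positivity)
    exact ⟨p, fun g hg => hp ⟨g, hg⟩⟩
  choose p hp using hfin
  have quad : ∀ (q : H) (g : G), inner ℝ (q - g.1.1) (q + (t • g.1.2 - z))
      = ‖q‖ ^ 2 + inner ℝ q (t • g.1.2 - z - g.1.1) - inner ℝ g.1.1 (t • g.1.2 - z) := by
    intro q g
    rw [inner_sub_left, inner_add_right, inner_add_right, real_inner_self_eq_norm_sq,
      inner_sub_right q _ g.1.1, real_inner_comm q g.1.1]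
    ring
  have hev : ∀ g : G, ∀ᶠ S in atTop, ‖p S‖ ^ 2 + inner ℝ (p S) (t • g.1.2 - z - g.1.1)
      ≤ inner ℝ g.1.1 (t • g.1.2 - z) := by
    intro g
    filter_upwards [eventually_ge_atTop ({g} : Finset G)] with S hS
    have := hp S g (hS (Finset.mem_singleton_self g))
    rw [quad] at this
    linarith
  -- Solutions for finite subsets of the graph are bounded by the condition at `g₀`; a weak limit
  -- along ever larger subsets satisfies every condition at once.
  let U : Ultrafilter (Finset G) := Ultrafilter.of atTop
  have hU : (U : Filter (Finset G)) ≤ atTop := Ultrafilter.of_le _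
  obtain ⟨q, hq⟩ := U.exists_weak_limit p
    (1 + ‖t • g₀.1.2 - z - g₀.1.1‖ + |inner ℝ g₀.1.1 (t • g₀.1.2 - z)|) (by
      filter_upwards [hU (hev g₀)] with S hS
      have h1 := neg_le_of_abs_le (abs_real_inner_le_norm (p S) (t • g₀.1.2 - z - g₀.1.1))
      have h2 := le_abs_self (inner ℝ g₀.1.1 (t • g₀.1.2 - z))
      have h3 := norm_nonneg (p S)
      have h4 := norm_nonneg (t • g₀.1.2 - z - g₀.1.1)
      have h5 := abs_nonneg (inner ℝ g₀.1.1 (t • g₀.1.2 - z))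
      by_contra! hlt
      nlinarith)
  refine ⟨q, fun g => ?_⟩
  rw [quad]
  have := norm_sq_add_inner_le_of_weak_limit hq _ _ (hU (hev g))
  linarith

/-- `F + γ A` is surjective for `A` maximally monotone and `F` strongly monotone and Lipschitz. -/
theorem IsMaximallyMonotone.exists_warped_resolvent {A : H → Set H} (hA : IsMaximallyMonotone A)
    {F : H → H} {α : ℝ} (hα : 0 < α) {χ : ℝ≥0} (hFα : IsStronglyMonotone α (single F))
    (hFχ : LipschitzWith χ F) {γ : ℝ} (hγ : 0 < γ) (z : H) :
    ∃ p, γ⁻¹ • (z - F p) ∈ A p := by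
  -- The solution is a fixed point of `p ↦ J (p + s • (z - F p))`, with `J` the nonexpansive
  -- resolvent of `(s * γ) A`. With `s = α / m`, the squared Lipschitz constant of `Id - s F` is at
  -- most `χ ^ 2 / m`. The term `α ^ 2` makes this less than 1 and keeps `m` positive even if `χ =
  -- 0`.
  set m : ℝ := (χ : ℝ) ^ 2 + α ^ 2 with hm
  have hm0 : 0 < m := by positivity
  set s : ℝ := α / m with hs
  have hs0 : 0 < s := by positivity
  choose J hJ using fun w => hA.exists_resolvent (mul_pos hs0 hγ) w
  have hJne : ∀ w w', ‖J w - J w'‖ ≤ ‖w - w'‖ := by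
    intro w w'
    have h := hA.1 (hJ w) (hJ w')
    rw [← smul_sub, inner_smul_right] at h
    have h1 := (mul_nonneg_iff_of_pos_left (by positivity)).1 h
    have h2 : w - J w - (w' - J w') = (w - w') - (J w - J w') := by abel
    rw [h2, inner_sub_right, real_inner_self_eq_norm_sq] at h1
    have h3 := real_inner_le_norm (J w - J w') (w - w')
    by_contra! hlt
    nlinarith [norm_nonneg (w - w')]
  let Φ : H → H := fun p => J (p + s • (z - F p))
  let k : ℝ≥0 := ⟨Real.sqrt ((χ : ℝ) ^ 2 / m), Real.sqrt_nonneg _⟩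
  have hk : k < 1 := by
    rw [← NNReal.coe_lt_coe]
    change Real.sqrt _ < 1
    rw [Real.sqrt_lt' one_pos, one_pow, div_lt_one hm0, hm]
    nlinarith
  have hlip : LipschitzWith k Φ := by
    refine LipschitzWith.of_dist_le_mul fun p q => ?_
    rw [dist_eq_norm, dist_eq_norm]
    refine (hJne _ _).trans ?_
    have h1 : p + s • (z - F p) - (q + s • (z - F q)) = (p - q) - s • (F p - F q) := by module
    have h2 : α * ‖p - q‖ ^ 2 ≤ inner ℝ (p - q) (F p - F q) := hFα rfl rfl
    have h3 : ‖F p - F q‖ ≤ χ * ‖p - q‖ := by simpa [dist_eq_norm] using hFχ.dist_le_mul p q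
    have h3' : ‖F p - F q‖ ^ 2 ≤ (χ : ℝ) ^ 2 * ‖p - q‖ ^ 2 := by
      rw [← mul_pow]; gcongr
    rw [h1]
    have hkk : (k : ℝ) * ‖p - q‖ = Real.sqrt ((χ : ℝ) ^ 2 / m * ‖p - q‖ ^ 2) := by
      rw [Real.sqrt_mul (by positivity), Real.sqrt_sq (norm_nonneg _)]; rfl
    rw [hkk]
    apply Real.le_sqrt_of_sq_le
    rw [norm_sub_sq_real, inner_smul_right, norm_smul, mul_pow, Real.norm_eq_abs, sq_abs]
    have h4 : ‖p - q‖ ^ 2 - 2 * (s * inner ℝ (p - q) (F p - F q)) + s ^ 2 * ‖F p - F q‖ ^ 2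
        ≤ (1 - 2 * (s * α) + s ^ 2 * χ ^ 2) * ‖p - q‖ ^ 2 := by
      have := mul_le_mul_of_nonneg_left h2 hs0.le
      have := mul_le_mul_of_nonneg_left h3' (sq_nonneg s)
      nlinarith
    refine h4.trans (mul_le_mul_of_nonneg_right ?_ (sq_nonneg _))
    have h5 : s * α = α ^ 2 / m := by rw [hs]; ring
    have h6 : s ^ 2 * (χ : ℝ) ^ 2 ≤ α ^ 2 / m := by
      rw [hs, div_pow, div_mul_eq_mul_div, div_le_div_iff₀ (by positivity) hm0]
      have : (χ : ℝ) ^ 2 ≤ m := by rw [hm]; nlinarith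
      have h7 : 0 ≤ α ^ 2 * m := by positivity
      nlinarith
    have h7 : (χ : ℝ) ^ 2 / m = 1 - α ^ 2 / m := by
      rw [eq_sub_iff_add_eq, ← add_div, div_self hm0.ne']
    rw [h5, h7]
    linarith
  have hc : ContractingWith k Φ := ⟨hk, hlip⟩
  refine ⟨ContractingWith.fixedPoint Φ hc, ?_⟩
  set p := ContractingWith.fixedPoint Φ hc with hp
  have hfix : J (p + s • (z - F p)) = p := hc.fixedPoint_isFixedPt
  have h := hJ (p + s • (z - F p))
  rw [hfix, add_sub_cancel_left, smul_smul] at h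
  convert h using 2
  field_simp

/-- Uniqueness: for two solutions, monotonicity of `A` forces `⟪q - p, F q - F p⟫ ≤ 0`, which strong
monotonicity of `F` allows only if they coincide. -/
theorem IsMaximallyMonotone.existsUnique_warped_resolvent {A : H → Set H}
    (hA : IsMaximallyMonotone A) {F : H → H} {α : ℝ} (hα : 0 < α) {χ : ℝ≥0}
    (hFα : IsStronglyMonotone α (single F)) (hFχ : LipschitzWith χ F) {γ : ℝ} (hγ : 0 < γ) (z : H) :
    ∃! p, p ∈ inv (add (single F) (smul γ A)) z := by
  obtain ⟨p, hp⟩ := hA.exists_warped_resolvent hα hFα hFχ hγ z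
  refine ⟨p, Set.mem_add.2 ⟨F p, rfl, _, Set.smul_mem_smul_set hp, ?_⟩, ?_⟩
  · rw [smul_smul, mul_inv_cancel₀ hγ.ne', one_smul]; abel
  · rintro q hq
    obtain ⟨-, rfl, -, ⟨w, hw, rfl⟩, h⟩ := Set.mem_add.1 hq
    have h1 := hA.1 hw hp
    have h2 : α * ‖q - p‖ ^ 2 ≤ inner ℝ (q - p) (F q - F p) := hFα rfl rfl
    have h3 : w - γ⁻¹ • (z - F p) = -(γ⁻¹ • (F q - F p)) := by
      rw [← h]
      simp only [smul_sub, smul_add, smul_smul, inv_mul_cancel₀ hγ.ne', one_smul]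
      abel
    rw [h3, inner_neg_right, inner_smul_right] at h1
    have h4 : inner ℝ (q - p) (F q - F p) ≤ 0 := by
      by_contra! h5
      have := mul_pos (inv_pos.2 hγ) h5
      linarith
    have h5 : ‖q - p‖ ^ 2 ≤ 0 := by
      by_contra! h6
      have := mul_pos hα h6
      linarith
    have h6 : ‖q - p‖ = 0 := by
      have := norm_nonneg (q - p)
      nlinarith
    exact sub_eq_zero.1 (norm_eq_zero.1 h6)

/-- Adding a monotone Lipschitz operator preserves maximal monotonicity. -/
theorem IsMaximallyMonotone.add_single {A : H → Set H} (hA : IsMaximallyMonotone A) {C : H → H}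
    (hC : IsMonotone (single C)) {μ : ℝ≥0} (hCμ : LipschitzWith μ C) :
    IsMaximallyMonotone (add A (single C)) := by
  have hmono : IsMonotone (add A (single C)) := by
    rintro x - y - ⟨u, hu, -, rfl, rfl⟩ ⟨v, hv, -, rfl, rfl⟩
    have h1 := hA.1 hu hv
    have h2 : 0 ≤ inner ℝ (x - y) (C x - C y) := hC rfl rfl
    have h3 : u + C x - (v + C y) = (u - v) + (C x - C y) := by abel
    simp only [h3, inner_add_right]
    positivity
  refine hmono.isMaximallyMonotone fun z => ?_
  -- Surjectivity of `Id + A + C` is that of `F + A` for the kernel `F = Id + C`.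
  have hF : IsStronglyMonotone 1 (single fun x => x + C x) := by
    rintro x - y - rfl rfl
    have h2 : 0 ≤ inner ℝ (x - y) (C x - C y) := hC rfl rfl
    rw [add_sub_add_comm, inner_add_right, real_inner_self_eq_norm_sq]
    linarith
  obtain ⟨p, hp⟩ := hA.exists_warped_resolvent one_pos hF (LipschitzWith.id.add hCμ) one_pos z
  refine ⟨p, Set.mem_add.2 ⟨_, hp, C p, rfl, ?_⟩⟩
  rw [inv_one, one_smul]
  abel

/-- Absorbs the right-hand side `s` of an inclusion, so that only zeros need to be sought. -/
theorem IsMaximallyMonotone.sub_const {A : H → Set H} (hA : IsMaximallyMonotone A) (s : H) :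
    IsMaximallyMonotone fun x => {u | u + s ∈ A x} := by
  refine IsMonotone.isMaximallyMonotone (fun x u y v hu hv => ?_) fun z => ?_
  · simpa using hA.1 hu hv
  · obtain ⟨p, hp⟩ := hA.exists_resolvent one_pos (z + s)
    refine ⟨p, ?_⟩
    simp only [inv_one, one_smul] at hp
    simpa [sub_add_eq_add_sub] using hp

end SetValued

/-! ### Fejér monotonicity and projections onto separating half-spaces. -/

section Fejer

variable {H : Type*} [NormedAddCommGroup H] [InnerProductSpace ℝ H]

/-- **Opial's lemma**, with weak cluster points expressed through ultrafilters. -/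
theorem exists_weak_limit_of_tendsto_norm_sub_sq [CompleteSpace H] {x : ℕ → H} {S : Set H}
    (hS : S.Nonempty) (hlim : ∀ z ∈ S, ∃ ℓ, Tendsto (fun n => ‖x n - z‖ ^ 2) atTop (𝓝 ℓ))
    (hcl : ∀ U : Ultrafilter ℕ, (U : Filter ℕ) ≤ atTop → ∀ p,
      (∀ w, Tendsto (fun n => inner ℝ (x n) w) U (𝓝 (inner ℝ p w))) → p ∈ S) :
    ∃ p ∈ S, ∀ w, Tendsto (fun n => inner ℝ (x n) w) atTop (𝓝 (inner ℝ p w)) := by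
  obtain ⟨z, hz⟩ := hS
  obtain ⟨ℓ, hℓ⟩ := hlim z hz
  have hbdd : ∀ᶠ n in atTop, ‖x n‖ ≤ ‖z‖ + (|ℓ| + 2) := by
    filter_upwards [hℓ.eventually_le_const (lt_add_one ℓ)] with n hn
    have h1 : ‖x n - z‖ ≤ |ℓ| + 2 := by
      by_contra! hlt
      nlinarith [abs_nonneg ℓ, le_abs_self ℓ]
    have h2 := norm_add_le z (x n - z)
    rw [add_sub_cancel] at h2
    linarith
  have hex : ∀ U : Ultrafilter ℕ, (U : Filter ℕ) ≤ atTop → ∃ p ∈ S,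
      ∀ w, Tendsto (fun n => inner ℝ (x n) w) U (𝓝 (inner ℝ p w)) := fun U hU => by
    obtain ⟨p, hp⟩ := U.exists_weak_limit x _ (hU hbdd)
    exact ⟨p, hcl U hU p hp, hp⟩
  obtain ⟨p, hpS, hp⟩ := hex _ (Ultrafilter.of_le atTop)
  refine ⟨p, hpS, fun w => tendsto_iff_ultrafilter _ _ _ |>.2 fun V hV => ?_⟩
  obtain ⟨q, hqS, hq⟩ := hex V hV
  suffices p = q by rw [this]; exact hq w
  obtain ⟨a, ha⟩ := hlim p hpS
  obtain ⟨b, hb⟩ := hlim q hqS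
  -- The difference of the two squared distances is affine in `x n`, so this inner product converges
  -- along the full sequence and both cluster points give it the same limit.
  have hdiff : Tendsto (fun n => inner ℝ (x n) (p - q)) atTop
      (𝓝 ((b - a + ‖p‖ ^ 2 - ‖q‖ ^ 2) / 2)) := by
    refine ((((hb.sub ha).add_const _).sub_const _).div_const 2).congr fun n => ?_
    rw [norm_sub_sq_real, norm_sub_sq_real, inner_sub_right]
    ring
  have h1 := tendsto_nhds_unique (hp (p - q)) (hdiff.mono_left (Ultrafilter.of_le atTop))
  have h2 := tendsto_nhds_unique (hq (p - q)) (hdiff.mono_left hV)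
  have h3 : inner ℝ (p - q) (p - q) = 0 := by
    rw [inner_sub_left, h1, h2, sub_self]
  exact sub_eq_zero.1 (inner_self_eq_zero.1 h3)

/-- The graph of a maximally monotone operator is closed for weak convergence in the domain and
strong convergence to `0` in the range. -/
theorem SetValued.IsMaximallyMonotone.zero_mem_of_weak_limit {M : H → Set H}
    (hM : IsMaximallyMonotone M) {l : Filter ℕ} [l.NeBot] {x p u : ℕ → H} {z : H} {R : ℝ}
    (hR : ∀ n, ‖x n‖ ≤ R) (hx : ∀ w, Tendsto (fun n => inner ℝ (x n) w) l (𝓝 (inner ℝ z w)))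
    (hpx : Tendsto (fun n => p n - x n) l (𝓝 0)) (hu : Tendsto u l (𝓝 0))
    (hmem : ∀ n, u n ∈ M (p n)) : 0 ∈ M z := by
  refine hM.mem_of_forall fun y v hv => ?_
  -- The only product of two varying sequences: `p n` is within a null error of a bounded sequence
  -- and `u n` tends to 0 in norm.
  have h1 : Tendsto (fun n => inner ℝ (p n) (u n)) l (𝓝 0) := by
    have hb : Tendsto (fun n => (‖p n - x n‖ + R) * ‖u n‖) l (𝓝 0) := by
      simpa using (hpx.norm.add_const R).mul hu.norm
    refine squeeze_zero_norm (fun n => (norm_inner_le_norm _ _).trans ?_) hb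
    gcongr
    have := norm_add_le (p n - x n) (x n)
    rw [sub_add_cancel] at this
    linarith [hR n]
  have h2 : Tendsto (fun n => inner ℝ (p n) v) l (𝓝 (inner ℝ z v)) := by
    have := (hpx.inner (tendsto_const_nhds (x := v))).add (hx v)
    simpa [← inner_add_left] using this
  have h3 : Tendsto (fun n => inner ℝ y (u n)) l (𝓝 0) := by
    simpa using (tendsto_const_nhds (x := y)).inner hu
  have h4 := ((h1.sub h2).sub h3).add_const (inner ℝ y v)
  refine (ge_of_tendsto' h4 (b := 0) fun n => ?_).trans_eq ?_
  · have := hM.1 (hmem n) hv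
    rw [inner_sub_left, inner_sub_right, inner_sub_right] at this
    linarith
  · rw [inner_sub_left, inner_sub_right, inner_sub_right]
    simp

/-- Weak convergence of the method of projections onto half-spaces separating the iterates from the
zeros of a maximally monotone operator. -/
theorem SetValued.IsMaximallyMonotone.exists_weak_limit_of_separating_projections [CompleteSpace H]
    {M : H → Set H} (hM : IsMaximallyMonotone M) (hne : ∃ z, 0 ∈ M z)
    {x x' p u : ℕ → H} {lam ρ : ℕ → ℝ} {ζ η lo hi : ℝ} (hζ : 0 < ζ) (hη : 0 < η) (hlo : 0 < lo)
    (hhi : hi < 2) (hlam : ∀ n, lo ≤ lam n ∧ lam n ≤ hi)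
    (hmem : ∀ n, u n ∈ M (p n)) (hu : ∀ n, ‖u n‖ ≤ ζ * ‖x' n - p n‖)
    (hcoer : ∀ n, η * ‖x' n - p n‖ ^ 2 ≤ inner ℝ (x' n - p n) (u n))
    (hρ : ∀ n, ρ n = if inner ℝ (p n - x n) (u n) < 0
      then lam n * inner ℝ (p n - x n) (u n) / ‖u n‖ ^ 2 else 0)
    (hx : ∀ n, x (n + 1) = x n + ρ n • u n)
    (hx' : Tendsto (fun n => x' n - x n) atTop (𝓝 0)) :
    ∃ z, 0 ∈ M z ∧ ∀ w, Tendsto (fun n => inner ℝ (x n) w) atTop (𝓝 (inner ℝ z w)) := by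
  set θ : ℕ → ℝ := fun n => inner ℝ (p n - x n) (u n) with hθ
  -- The squared distance from `x n` to the half-space `⟪z - p n, u n⟫ ≤ 0`; it vanishes when no
  -- step is taken.
  set q : ℕ → ℝ := fun n => (min (θ n) 0) ^ 2 / ‖u n‖ ^ 2 with hq
  have hq0 : ∀ n, 0 ≤ q n := fun n => by positivity
  have hc : 0 < lo * (2 - hi) := mul_pos hlo (by linarith)
  have hfejer : ∀ z, 0 ∈ M z → ∀ n,
      ‖x (n + 1) - z‖ ^ 2 ≤ ‖x n - z‖ ^ 2 - lo * (2 - hi) * q n := by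
    intro z hz n
    rw [hx n, hρ n]
    change ‖x n + (if θ n < 0 then lam n * θ n / ‖u n‖ ^ 2 else 0) • u n - z‖ ^ 2 ≤ _
    split_ifs with hneg
    · have hun : 0 < ‖u n‖ := by
        rw [norm_pos_iff]
        intro h0
        simp [hθ, h0] at hneg
      have h1 := hM.1 (hmem n) hz
      rw [sub_zero] at h1
      have h2 : inner ℝ (x n - z) (u n) = inner ℝ (p n - z) (u n) - θ n := by
        simp only [hθ, inner_sub_left]; ring
      have h3 : lo * (2 - hi) ≤ lam n * (2 - lam n) := by
        obtain ⟨ha, hb⟩ := hlam n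
        have : lo * (2 - hi) ≤ lam n * (2 - hi) := by gcongr
        have : lam n * (2 - hi) ≤ lam n * (2 - lam n) := by gcongr; linarith
        linarith
      have h4 : lo * (2 - hi) * q n ≤ lam n * (2 - lam n) * q n := by
        gcongr
      have h5 : q n = θ n ^ 2 / ‖u n‖ ^ 2 := by simp only [hq, min_eq_left hneg.le]
      set ω := lam n * θ n / ‖u n‖ ^ 2 with hω
      have hω0 : ω ≤ 0 := div_nonpos_of_nonpos_of_nonneg
        (mul_nonpos_of_nonneg_of_nonpos (hlo.le.trans (hlam n).1) hneg.le) (by positivity)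
      have h6 : ω * θ n = lam n * q n := by rw [hω, h5]; ring
      have h7 : ω ^ 2 * ‖u n‖ ^ 2 = lam n ^ 2 * q n := by
        rw [hω, h5]; field_simp
      have h8 : x n + ω • u n - z = (x n - z) + ω • u n := by abel
      rw [h8, norm_add_sq_real, inner_smul_right, norm_smul, mul_pow, Real.norm_eq_abs, sq_abs, h7,
        h2]
      have h9 := mul_nonpos_of_nonpos_of_nonneg hω0 h1
      nlinarith
    · have h5 : q n = 0 := by simp only [hq, min_eq_right (not_lt.1 hneg)]; simp
      simp [h5]
  have hconv : ∀ z, 0 ∈ M z → ∃ ℓ, Tendsto (fun n => ‖x n - z‖ ^ 2) atTop (𝓝 ℓ) := by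
    intro z hz
    refine ⟨_, tendsto_atTop_ciInf (antitone_nat_of_succ_le fun n => ?_)
      ⟨0, by rintro _ ⟨n, rfl⟩; positivity⟩⟩
    have := hfejer z hz n
    have := mul_nonneg hc.le (hq0 n)
    linarith
  obtain ⟨z₀, hz₀⟩ := hne
  have hqlim : Tendsto q atTop (𝓝 0) := by
    obtain ⟨ℓ, hℓ⟩ := hconv z₀ hz₀
    have h1 := (hℓ.sub (hℓ.comp (tendsto_add_atTop_nat 1))).div_const (lo * (2 - hi))
    rw [sub_self, zero_div] at h1
    refine squeeze_zero hq0 (fun n => ?_) h1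
    rw [le_div_iff₀ hc]
    have := hfejer z₀ hz₀ n
    simp only [Function.comp]
    linarith
  have hd : Tendsto (fun n => ‖x' n - p n‖) atTop (𝓝 0) := by
    have hb : Tendsto (fun n => 2 * ζ / η * ‖x' n - x n‖ + 2 * ζ / η * √(q n)) atTop (𝓝 0) := by
      simpa using (hx'.norm.const_mul (2 * ζ / η)).add ((hqlim.sqrt).const_mul (2 * ζ / η))
    refine squeeze_zero (fun n => norm_nonneg _) (fun n => ?_) hb
    set d := ‖x' n - p n‖ with hd
    set e := ‖x' n - x n‖ with he
    have hd0 : 0 ≤ d := norm_nonneg _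
    have he0 : 0 ≤ e := norm_nonneg _
    -- Beyond this threshold the error `⟪x' n - x n, u n⟫ ≤ ζ * e * d` consumes at most half of the
    -- coercivity `η * d ^ 2`. The half-space then genuinely cuts off `x n`, at a distance of order
    -- `d`.
    rcases le_or_gt d (2 * ζ / η * e) with h1 | h1
    · have : 0 ≤ 2 * ζ / η * √(q n) := by positivity
      linarith
    suffices d ≤ 2 * ζ / η * √(q n) by
      have : 0 ≤ 2 * ζ / η * e := by positivity
      linarith
    have hdpos : 0 < d := lt_of_le_of_lt (by positivity) h1
    have h2 : 2 * ζ * e < η * d := by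
      rw [div_mul_eq_mul_div, div_lt_iff₀ hη] at h1
      linarith
    have h3 : θ n = inner ℝ (x' n - x n) (u n) - inner ℝ (x' n - p n) (u n) := by
      simp only [hθ, inner_sub_left]; ring
    have h4 : inner ℝ (x' n - x n) (u n) ≤ e * (ζ * d) :=
      (real_inner_le_norm _ _).trans (by gcongr; exact hu n)
    have h5 : θ n ≤ -(η * d ^ 2 / 2) := by
      have := hcoer n
      nlinarith
    have h6 : 0 < η * d ^ 2 / 2 := by positivity
    have hneg : θ n < 0 := by linarith
    have hun : 0 < ‖u n‖ := by
      rw [norm_pos_iff]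
      intro h0
      simp [hθ, h0] at hneg
    have h7 : (η * d / (2 * ζ)) ^ 2 ≤ q n := by
      simp only [hq, min_eq_left hneg.le]
      rw [le_div_iff₀ (by positivity)]
      calc (η * d / (2 * ζ)) ^ 2 * ‖u n‖ ^ 2 ≤ (η * d / (2 * ζ)) ^ 2 * (ζ * d) ^ 2 := by
            gcongr; exact hu n
        _ = (η * d ^ 2 / 2) ^ 2 := by field_simp
        _ ≤ θ n ^ 2 := by nlinarith
    have h8 := Real.le_sqrt_of_sq_le h7
    calc d = 2 * ζ / η * (η * d / (2 * ζ)) := by field_simp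
      _ ≤ _ := by gcongr
  have hpx' : Tendsto (fun n => x' n - p n) atTop (𝓝 0) := tendsto_zero_iff_norm_tendsto_zero.2 hd
  have hpx : Tendsto (fun n => p n - x n) atTop (𝓝 0) := by
    simpa using hx'.sub hpx'
  have hulim : Tendsto u atTop (𝓝 0) :=
    squeeze_zero_norm hu (by simpa using hd.const_mul ζ)
  have hbdd : ∀ n, ‖x n‖ ≤ ‖z₀‖ + ‖x 0 - z₀‖ := by
    intro n
    have h1 : ‖x n - z₀‖ ≤ ‖x 0 - z₀‖ := by
      induction n with
      | zero => rfl
      | succ k ih =>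
        refine le_trans (abs_le_of_sq_le_sq' ?_ (norm_nonneg _)).2 ih
        have := hfejer z₀ hz₀ k
        have := mul_nonneg hc.le (hq0 k)
        linarith
    have h2 := norm_add_le z₀ (x n - z₀)
    rw [add_sub_cancel] at h2
    linarith
  exact exists_weak_limit_of_tendsto_norm_sub_sq (S := {z | 0 ∈ M z}) ⟨z₀, hz₀⟩ hconv
    fun U hU z hz => hM.zero_mem_of_weak_limit hbdd hz (hpx.mono_left hU) (hulim.mono_left hU) hmem

end Fejer

/-! ### The saddle operator and projective splitting for one composite inclusion. -/

namespace SetValued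

section Product

variable {H K : Type*} [NormedAddCommGroup H] [InnerProductSpace ℝ H]
  [NormedAddCommGroup K] [InnerProductSpace ℝ K]

/-- The product of two set-valued operators on the Hilbert direct sum. -/
def prod (M : H → Set H) (N : K → Set K) : WithLp 2 (H × K) → Set (WithLp 2 (H × K)) :=
  fun x => {u | u.fst ∈ M x.fst ∧ u.snd ∈ N x.snd}

theorem IsMaximallyMonotone.prod [CompleteSpace H] [CompleteSpace K] {M : H → Set H}
    {N : K → Set K} (hM : IsMaximallyMonotone M) (hN : IsMaximallyMonotone N) :
    IsMaximallyMonotone (prod M N) := by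
  refine IsMonotone.isMaximallyMonotone ?_ fun z => ?_
  · rintro x u y v ⟨hu₁, hu₂⟩ ⟨hv₁, hv₂⟩
    rw [WithLp.prod_inner_apply]
    exact add_nonneg (hM.1 hu₁ hv₁) (hN.1 hu₂ hv₂)
  · obtain ⟨p, hp⟩ := hM.exists_resolvent one_pos z.fst
    obtain ⟨q, hq⟩ := hN.exists_resolvent one_pos z.snd
    rw [inv_one, one_smul] at hp hq
    exact ⟨WithLp.toLp 2 (p, q), hp, hq⟩

theorem isMaximallyMonotone_zero [CompleteSpace H] :
    IsMaximallyMonotone (single (0 : H → H)) := by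
  refine IsMonotone.isMaximallyMonotone ?_ fun z => ⟨z, by simp [single]⟩
  rintro x - y - rfl rfl
  simp

end Product

section Saddle

variable {H K : Type*} [NormedAddCommGroup H] [InnerProductSpace ℝ H] [CompleteSpace H]
  [NormedAddCommGroup K] [InnerProductSpace ℝ K] [CompleteSpace K]

/-- The skew part of the saddle operator of a composite inclusion. -/
noncomputable def skew (L : H →L[ℝ] K) :
    WithLp 2 (H × WithLp 2 (K × K)) →L[ℝ] WithLp 2 (H × WithLp 2 (K × K)) :=
  let e := (WithLp.prodContinuousLinearEquiv 2 ℝ H (WithLp 2 (K × K)))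
  let e' := (WithLp.prodContinuousLinearEquiv 2 ℝ K K)
  let X := ContinuousLinearMap.fst ℝ H (WithLp 2 (K × K)) ∘L e.toContinuousLinearMap
  let YV := e'.toContinuousLinearMap ∘L
    ContinuousLinearMap.snd ℝ H (WithLp 2 (K × K)) ∘L e.toContinuousLinearMap
  let Y := ContinuousLinearMap.fst ℝ K K ∘L YV
  let V := ContinuousLinearMap.snd ℝ K K ∘L YV
  e.symm.toContinuousLinearMap ∘L
    ((ContinuousLinearMap.adjoint L ∘L V).prod
      (e'.symm.toContinuousLinearMap ∘L ((-V).prod (Y - L ∘L X))))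

theorem skew_apply (L : H →L[ℝ] K) (x : WithLp 2 (H × WithLp 2 (K × K))) :
    skew L x = WithLp.toLp 2 (ContinuousLinearMap.adjoint L x.snd.snd,
      WithLp.toLp 2 (-x.snd.snd, x.snd.fst - L x.fst)) := rfl

/-- The saddle operator `(x, y, v) ↦ (M x + L* v) × (N y - v) × {r + y - L x}`. -/
noncomputable def saddle (M : H → Set H) (N : K → Set K) (L : H →L[ℝ] K) (r : K) :
    WithLp 2 (H × WithLp 2 (K × K)) → Set (WithLp 2 (H × WithLp 2 (K × K))) :=
  add (prod M (prod N (single 0)))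
    (single fun x => skew L x + WithLp.toLp 2 (0, WithLp.toLp 2 (0, r)))

/-- The linear part satisfies `⟪d, skew L d⟫ = 0`, so it is monotone and Lipschitz and perturbs the
product operator without losing maximality. -/
theorem IsMaximallyMonotone.saddle {M : H → Set H} {N : K → Set K} (hM : IsMaximallyMonotone M)
    (hN : IsMaximallyMonotone N) (L : H →L[ℝ] K) (r : K) :
    IsMaximallyMonotone (saddle M N L r) := by
  refine (hM.prod (hN.prod isMaximallyMonotone_zero)).add_single ?_
    ((skew L).lipschitz.add (LipschitzWith.const _))
  rintro x - y - rfl rfl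
  rw [add_sub_add_right_eq_sub, ← map_sub, skew_apply]
  set d := x - y
  simp only [WithLp.prod_inner_apply, ContinuousLinearMap.adjoint_inner_right, inner_neg_right,
    inner_sub_right]
  change 0 ≤ inner ℝ (L d.fst) d.snd.snd + (-inner ℝ d.snd.fst d.snd.snd
    + (inner ℝ d.snd.snd d.snd.fst - inner ℝ d.snd.snd (L d.fst)))
  rw [real_inner_comm d.snd.snd d.snd.fst, real_inner_comm d.snd.snd (L d.fst)]
  linarith

theorem mem_saddle {M : H → Set H} {N : K → Set K} {L : H →L[ℝ] K} {r : K}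
    {x u : WithLp 2 (H × WithLp 2 (K × K))} :
    u ∈ saddle M N L r x ↔ u.fst - ContinuousLinearMap.adjoint L x.snd.snd ∈ M x.fst ∧
      u.snd.fst + x.snd.snd ∈ N x.snd.fst ∧ u.snd.snd = r + x.snd.fst - L x.fst := by
  constructor
  · rintro ⟨w, ⟨hw₁, hw₂, hw₃⟩, -, rfl, rfl⟩
    have hw₃' : w.snd.snd = 0 := hw₃
    refine ⟨?_, ?_, ?_⟩
    · simpa [skew_apply] using hw₁
    · simpa [skew_apply] using hw₂
    · simp [skew_apply, hw₃']
      abel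
  · rintro ⟨h₁, h₂, h₃⟩
    refine ⟨WithLp.toLp 2 (u.fst - ContinuousLinearMap.adjoint L x.snd.snd,
      WithLp.toLp 2 (u.snd.fst + x.snd.snd, 0)), ⟨h₁, h₂, rfl⟩, _, rfl, ?_⟩
    refine WithLp.ofLp_injective 2 (Prod.ext ?_ (WithLp.ofLp_injective 2 (Prod.ext ?_ ?_)))
    · simp [skew_apply]
    · simp [skew_apply]
    · simp [skew_apply, h₃]
      abel

/-- Weak convergence of the projective splitting method with warped kernels for a composite
inclusion `0 ∈ M x + L* N (L x - r)`. The vectors `g n` and `h n` are the increments of the kernels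
between evaluation points and resolvent points. -/
theorem exists_weak_limit_of_projective_splitting {M : H → Set H} {N : K → Set K}
    (hM : IsMaximallyMonotone M) (hN : IsMaximallyMonotone N) (L : H →L[ℝ] K) (r : K)
    (hne : ∃ x v, -ContinuousLinearMap.adjoint L v ∈ M x ∧ v ∈ N (L x - r))
    {x x' a aStar g : ℕ → H} {y y' v v' b c bStar cStar h : ℕ → K} {lam ρ θ σ : ℕ → ℝ}
    {ζ η lo hi : ℝ} (hζ : 0 < ζ) (hη : 0 < η) (hlo : 0 < lo)
    (hhi : hi < 2) (hlam : ∀ n, lo ≤ lam n ∧ lam n ≤ hi)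
    (hg : ∀ n, ‖g n‖ ≤ ζ * ‖x' n - a n‖)
    (hg' : ∀ n, η * ‖x' n - a n‖ ^ 2 ≤ inner ℝ (x' n - a n) (g n))
    (hh : ∀ n, ‖h n‖ ≤ ζ * ‖y' n - b n‖)
    (hh' : ∀ n, η * ‖y' n - b n‖ ^ 2 ≤ inner ℝ (y' n - b n) (h n))
    (ha : ∀ n, aStar n - ContinuousLinearMap.adjoint L (c n) ∈ M (a n))
    (hb : ∀ n, bStar n + c n ∈ N (b n))
    (haStar : ∀ n, aStar n = g n - ContinuousLinearMap.adjoint L (v' n - c n))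
    (hbStar : ∀ n, bStar n = h n + (v' n - c n))
    (hc : ∀ n, c n = L (x' n) - y' n + v' n - r)
    (hcStar : ∀ n, cStar n = r + b n - L (a n))
    (hσ : ∀ n, σ n = ‖aStar n‖ ^ 2 + (‖bStar n‖ ^ 2 + ‖cStar n‖ ^ 2))
    (hθ : ∀ n, θ n = inner ℝ (a n - x n) (aStar n)
      + (inner ℝ (b n - y n) (bStar n) + inner ℝ (c n - v n) (cStar n)))
    (hρ : ∀ n, ρ n = if θ n < 0 then lam n * θ n / σ n else 0)
    (hx : ∀ n, x (n + 1) = x n + ρ n • aStar n)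
    (hy : ∀ n, y (n + 1) = y n + ρ n • bStar n)
    (hv : ∀ n, v (n + 1) = v n + ρ n • cStar n)
    (hx' : Tendsto (fun n => x' n - x n) atTop (𝓝 0))
    (hy' : Tendsto (fun n => y' n - y n) atTop (𝓝 0))
    (hv' : Tendsto (fun n => v' n - v n) atTop (𝓝 0)) :
    ∃ xbar vbar, -ContinuousLinearMap.adjoint L vbar ∈ M xbar ∧ vbar ∈ N (L xbar - r) ∧
      (∀ w, Tendsto (fun n => inner ℝ (x n) w) atTop (𝓝 (inner ℝ xbar w))) ∧
      ∀ w, Tendsto (fun n => inner ℝ (v n) w) atTop (𝓝 (inner ℝ vbar w)) := by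
  let mk : H → K → K → WithLp 2 (H × WithLp 2 (K × K)) :=
    fun p q w => WithLp.toLp 2 (p, WithLp.toLp 2 (q, w))
  have norm_mk : ∀ p q w, ‖mk p q w‖ ^ 2 = ‖p‖ ^ 2 + (‖q‖ ^ 2 + ‖w‖ ^ 2) := fun p q w => by
    rw [WithLp.prod_norm_sq_eq_of_L2, WithLp.prod_norm_sq_eq_of_L2]
    rfl
  have sub_mk : ∀ p q w p' q' w', mk p q w - mk p' q' w' = mk (p - p') (q - q') (w - w') :=
    fun _ _ _ _ _ _ => rfl
  have inner_mk : ∀ p q w p' q' w', inner ℝ (mk p q w) (mk p' q' w')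
      = inner ℝ p p' + (inner ℝ q q' + inner ℝ w w') := fun _ _ _ _ _ _ => by
    simp only [WithLp.prod_inner_apply, mk]
  have zero_iff : ∀ z : WithLp 2 (H × WithLp 2 (K × K)), 0 ∈ saddle M N L r z ↔
      -ContinuousLinearMap.adjoint L z.snd.snd ∈ M z.fst ∧ z.snd.snd ∈ N z.snd.fst ∧
        z.snd.fst = L z.fst - r := fun z => by
    rw [mem_saddle]
    simp only [WithLp.zero_fst, WithLp.zero_snd, zero_sub, zero_add, eq_comm (a := (0 : K)), sub_eq_zero]
    refine and_congr_right fun _ => and_congr_right fun _ => ?_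
    rw [eq_sub_iff_add_eq, add_comm]
  -- In terms of displacements, `(aStar, bStar, cStar)` is `(g, h, v' - c)` minus `skew L` of the
  -- displacement, which gives both the norm bound and the coercivity. The third kernel is the
  -- identity, hence the constant `min η 1` below.
  have hcS : ∀ n, cStar n = L (x' n - a n) - (y' n - b n) + (v' n - c n) := fun n => by
    rw [hcStar, hc, map_sub]; abel
  have hZ : 0 < 2 * ζ + 3 * ‖L‖ + 4 := by positivity
  have hlim : ∃ z, 0 ∈ saddle M N L r z ∧ ∀ w, Tendsto (fun n => inner ℝ (mk (x n) (y n) (v n)) w)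
      atTop (𝓝 (inner ℝ z w)) := by
    refine (hM.saddle hN L r).exists_weak_limit_of_separating_projections
      (x := fun n => mk (x n) (y n) (v n)) (x' := fun n => mk (x' n) (y' n) (v' n))
      (p := fun n => mk (a n) (b n) (c n)) (u := fun n => mk (aStar n) (bStar n) (cStar n))
      (lam := lam) (ρ := ρ) (ζ := 2 * ζ + 3 * ‖L‖ + 4) (η := min η 1) ?_ hZ (lt_min hη one_pos)
      hlo hhi hlam ?_ ?_ ?_ ?_ ?_ ?_
    · obtain ⟨p, w, h₁, h₂⟩ := hne
      exact ⟨mk p (L p - r) w, (zero_iff _).2 ⟨h₁, h₂, rfl⟩⟩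
    · exact fun n => mem_saddle.2 ⟨ha n, hb n, hcStar n⟩
    · intro n
      simp only [sub_mk]
      set d := mk (x' n - a n) (y' n - b n) (v' n - c n) with hd
      have hd2 := norm_mk (x' n - a n) (y' n - b n) (v' n - c n)
      rw [← hd] at hd2
      have e1 : ‖x' n - a n‖ ≤ ‖d‖ := by
        refine (abs_le_of_sq_le_sq' ?_ (norm_nonneg d)).2
        nlinarith [sq_nonneg ‖y' n - b n‖, sq_nonneg ‖v' n - c n‖]
      have e2 : ‖y' n - b n‖ ≤ ‖d‖ := by
        refine (abs_le_of_sq_le_sq' ?_ (norm_nonneg d)).2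
        nlinarith [sq_nonneg ‖x' n - a n‖, sq_nonneg ‖v' n - c n‖]
      have e3 : ‖v' n - c n‖ ≤ ‖d‖ := by
        refine (abs_le_of_sq_le_sq' ?_ (norm_nonneg d)).2
        nlinarith [sq_nonneg ‖y' n - b n‖, sq_nonneg ‖x' n - a n‖]
      have f1 : ‖aStar n‖ ≤ (ζ + ‖L‖) * ‖d‖ := by
        rw [haStar, add_mul]
        refine (norm_sub_le _ _).trans (add_le_add ((hg n).trans (by gcongr)) ?_)
        refine (ContinuousLinearMap.le_opNorm _ _).trans ?_
        rw [LinearIsometryEquiv.norm_map]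
        gcongr
      have f2 : ‖bStar n‖ ≤ (ζ + 1) * ‖d‖ := by
        rw [hbStar, add_mul, one_mul]
        exact (norm_add_le _ _).trans (add_le_add ((hh n).trans (by gcongr)) e3)
      have f3 : ‖cStar n‖ ≤ (‖L‖ + 2) * ‖d‖ := by
        rw [hcS]
        have := norm_add_le (L (x' n - a n) - (y' n - b n)) (v' n - c n)
        have := norm_sub_le (L (x' n - a n)) (y' n - b n)
        have := (L.le_opNorm (x' n - a n)).trans (mul_le_mul_of_nonneg_left e1 (norm_nonneg _))
        linarith
      have f4 : ‖mk (aStar n) (bStar n) (cStar n)‖ ≤ ‖aStar n‖ + ‖bStar n‖ + ‖cStar n‖ := by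
        refine (abs_le_of_sq_le_sq' ?_ (by positivity)).2
        rw [norm_mk]
        nlinarith [norm_nonneg (aStar n), norm_nonneg (bStar n), norm_nonneg (cStar n),
          mul_nonneg (norm_nonneg (aStar n)) (norm_nonneg (bStar n)),
          mul_nonneg (norm_nonneg (aStar n)) (norm_nonneg (cStar n)),
          mul_nonneg (norm_nonneg (bStar n)) (norm_nonneg (cStar n))]
      have := mul_nonneg (norm_nonneg L) (norm_nonneg d)
      nlinarith [norm_nonneg d]
    · intro n
      simp only [sub_mk, norm_mk, inner_mk]
      -- The cross terms with `L` and with `y' - b` cancel in the sum of the three inner products,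
      -- by skewness.
      have e1 : inner ℝ (x' n - a n) (aStar n) = inner ℝ (x' n - a n) (g n)
          - inner ℝ (L (x' n - a n)) (v' n - c n) := by
        rw [haStar, inner_sub_right, ContinuousLinearMap.adjoint_inner_right]
      have e2 : inner ℝ (y' n - b n) (bStar n) = inner ℝ (y' n - b n) (h n)
          + inner ℝ (y' n - b n) (v' n - c n) := by
        rw [hbStar, inner_add_right]
      have e3 : inner ℝ (v' n - c n) (cStar n) = inner ℝ (L (x' n - a n)) (v' n - c n)
          - inner ℝ (y' n - b n) (v' n - c n) + ‖v' n - c n‖ ^ 2 := by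
        rw [hcS, inner_add_right, inner_sub_right, real_inner_self_eq_norm_sq,
          real_inner_comm (v' n - c n), real_inner_comm (v' n - c n)]
      rw [e1, e2, e3]
      have h1 : min η 1 * ‖x' n - a n‖ ^ 2 ≤ η * ‖x' n - a n‖ ^ 2 := by
        gcongr; exact min_le_left _ _
      have h2 : min η 1 * ‖y' n - b n‖ ^ 2 ≤ η * ‖y' n - b n‖ ^ 2 := by
        gcongr; exact min_le_left _ _
      have h3 : min η 1 * ‖v' n - c n‖ ^ 2 ≤ 1 * ‖v' n - c n‖ ^ 2 := by
        gcongr; exact min_le_right _ _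
      linarith [hg' n, hh' n]
    · intro n
      simp only [sub_mk, norm_mk, inner_mk]
      rw [hρ, ← hθ, ← hσ]
    · intro n
      change mk _ _ _ = _
      rw [hx, hy, hv]
      rfl
    · rw [tendsto_zero_iff_norm_tendsto_zero]
      have h1 : Tendsto (fun n => √(‖x' n - x n‖ ^ 2 + (‖y' n - y n‖ ^ 2 + ‖v' n - v n‖ ^ 2)))
          atTop (𝓝 0) := by
        simpa using ((hx'.norm.pow 2).add ((hy'.norm.pow 2).add (hv'.norm.pow 2))).sqrt
      refine h1.congr fun n => ?_
      rw [sub_mk, ← norm_mk, Real.sqrt_sq (norm_nonneg _)]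
  obtain ⟨z, hz, hlim⟩ := hlim
  obtain ⟨h₁, h₂, h₃⟩ := (zero_iff z).1 hz
  refine ⟨z.fst, z.snd.snd, h₁, h₃ ▸ h₂, fun w => ?_, fun w => ?_⟩
  · simpa [mk, WithLp.prod_inner_apply] using hlim (mk w 0 0)
  · simpa [mk, WithLp.prod_inner_apply] using hlim (mk 0 0 w)

end Saddle

end SetValued

/-! ### Weak topology, uniform constants and estimates on finite direct sums. -/

/-- By Riesz representation, inner products exhaust the functionals that define the weak topology.
-/
theorem weaklyConverges_of_forall_inner {H : Type*} [NormedAddCommGroup H] [InnerProductSpace ℝ H]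
    [CompleteSpace H] {x : ℕ → H} {p : H}
    (h : ∀ w, Tendsto (fun n => inner ℝ (x n) w) atTop (𝓝 (inner ℝ p w))) :
    WeaklyConverges x p := by
  unfold WeaklyConverges
  refine (WeakBilin.tendsto_iff_forall_eval_tendsto (topDualPairing ℝ H).flip
    (fun x y hxy => ext_inner_right ℝ fun w => by
      have := LinearMap.congr_fun hxy (InnerProductSpace.toDual ℝ H w)
      change InnerProductSpace.toDual ℝ H w x = InnerProductSpace.toDual ℝ H w y at this
      simpa [real_inner_comm] using this)).2 fun f => ?_
  have h1 := h ((InnerProductSpace.toDual ℝ H).symm f)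
  simp only [real_inner_comm ((InnerProductSpace.toDual ℝ H).symm f),
    InnerProductSpace.toDual_symm_apply] at h1
  exact h1

theorem exists_pos_forall_le {ι : Type*} [Finite ι] {f : ι → ℝ} (hf : ∀ i, 0 < f i) :
    ∃ c, 0 < c ∧ ∀ i, c ≤ f i := by
  rcases isEmpty_or_nonempty ι with h | h
  · exact ⟨1, one_pos, fun i => (h.false i).elim⟩
  · obtain ⟨i, hi⟩ := Finite.exists_min f
    exact ⟨f i, hf i, hi⟩

theorem exists_pos_forall_ge {ι : Type*} [Finite ι] (f : ι → ℝ) :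
    ∃ c, 0 < c ∧ ∀ i, f i ≤ c := by
  obtain ⟨c, hc⟩ := (Set.finite_range f).bddAbove
  exact ⟨max c 1, by positivity, fun i => (hc ⟨i, rfl⟩).trans (le_max_left _ _)⟩

section PiLpBounds

variable {I : Type*} [Fintype I] {Y : I → Type*} [∀ i, NormedAddCommGroup (Y i)]

theorem PiLp.norm_le_mul_of_forall {u d : PiLp 2 Y} {ζ : ℝ} (hζ : 0 ≤ ζ)
    (h : ∀ i, ‖u i‖ ≤ ζ * ‖d i‖) : ‖u‖ ≤ ζ * ‖d‖ := by
  refine (abs_le_of_sq_le_sq' ?_ (by positivity)).2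
  rw [mul_pow, PiLp.norm_sq_eq_of_L2, PiLp.norm_sq_eq_of_L2, Finset.mul_sum]
  gcongr with i
  rw [← mul_pow]
  gcongr
  exact h i

theorem PiLp.mul_norm_sq_le_inner_of_forall [∀ i, InnerProductSpace ℝ (Y i)] {u d : PiLp 2 Y} {η : ℝ}
    (h : ∀ i, η * ‖d i‖ ^ 2 ≤ inner ℝ (d i) (u i)) : η * ‖d‖ ^ 2 ≤ inner ℝ d u := by
  rw [PiLp.norm_sq_eq_of_L2, PiLp.inner_apply, Finset.mul_sum]
  gcongr with i
  exact h i

theorem PiLp.tendsto_zero_of_forall {u : ℕ → PiLp 2 Y}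
    (h : ∀ i, Tendsto (fun n => u n i) atTop (𝓝 0)) : Tendsto u atTop (𝓝 0) := by
  have h1 : Tendsto (fun n => √(∑ i, ‖u n i‖ ^ 2)) atTop (𝓝 0) := by
    simpa using (tendsto_finsetSum Finset.univ fun i _ => (h i).norm.pow 2).sqrt
  rw [tendsto_zero_iff_norm_tendsto_zero]
  refine h1.congr fun n => ?_
  rw [PiLp.norm_eq_of_L2]

end PiLpBounds

/-! ### Warped kernels and coordinatewise operators. -/

namespace SetValued

section Kernel

variable {H : Type*} [NormedAddCommGroup H] [InnerProductSpace ℝ H]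
  {F C : H → H} {α ε γ : ℝ} {χ μ : ℝ≥0}

theorem sub_pos_of_mem_Ioo_div (hα : 0 < α) (hε : ε ∈ Set.Ioo 0 (α / (μ + 1))) : 0 < α - ε := by
  have h : α / ((μ : ℝ) + 1) ≤ α := div_le_self hα.le (by linarith [μ.coe_nonneg])
  linarith [hε.2]

/-- The warped kernel `γ⁻¹ F - C` is strongly monotone, uniformly in the admissible `γ`. -/
theorem IsStronglyMonotone.warped_kernel (hα : 0 < α) (hμ : 0 < μ)
    (hε : ε ∈ Set.Ioo 0 (α / (μ + 1))) (hγ : γ ∈ Set.Icc ε ((α - ε) / μ))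
    (hF : IsStronglyMonotone α (single F)) (hC : LipschitzWith μ C) (p q : H) :
    ε * μ / (α - ε) * ‖p - q‖ ^ 2 ≤ inner ℝ (p - q) (γ⁻¹ • (F p - F q) - (C p - C q)) := by
  have hαε := sub_pos_of_mem_Ioo_div hα hε
  have hγ0 : 0 < γ := hε.1.trans_le hγ.1
  have hμ0 : (0 : ℝ) < μ := hμ
  have h1 : α * ‖p - q‖ ^ 2 ≤ inner ℝ (p - q) (F p - F q) := hF rfl rfl
  have h2 : inner ℝ (p - q) (C p - C q) ≤ μ * ‖p - q‖ ^ 2 := by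
    have h3 : ‖C p - C q‖ ≤ μ * ‖p - q‖ := by simpa [dist_eq_norm] using hC.dist_le_mul p q
    calc _ ≤ ‖p - q‖ * ‖C p - C q‖ := real_inner_le_norm _ _
      _ ≤ ‖p - q‖ * (μ * ‖p - q‖) := by gcongr
      _ = _ := by ring
  have h4 : γ * μ ≤ α - ε := (le_div_iff₀ hμ0).1 hγ.2
  -- The upper bound on `γ` is used twice: `α - γ * μ ≥ ε` and `1 / γ ≥ μ / (α - ε)`.
  have h5 : ε * μ / (α - ε) ≤ γ⁻¹ * α - μ := by
    have h6 : γ⁻¹ * α - μ = (α - γ * μ) / γ := by field_simp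
    rw [h6, div_le_div_iff₀ hαε hγ0]
    calc ε * μ * γ = ε * (γ * μ) := by ring
      _ ≤ ε * (α - ε) := by gcongr; exact hε.1.le
      _ ≤ (α - γ * μ) * (α - ε) := by gcongr; linarith
  rw [inner_sub_right, inner_smul_right]
  have h7 := mul_le_mul_of_nonneg_left h1 (inv_pos.2 hγ0).le
  have h8 := mul_le_mul_of_nonneg_right h5 (sq_nonneg ‖p - q‖)
  linarith

theorem norm_warped_kernel_le (hε : 0 < ε) (hγ : ε ≤ γ) (hF : LipschitzWith χ F)
    (hC : LipschitzWith μ C) (p q : H) :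
    ‖γ⁻¹ • (F p - F q) - (C p - C q)‖ ≤ (χ / ε + μ) * ‖p - q‖ := by
  have hγ0 : 0 < γ := hε.trans_le hγ
  have h1 : ‖F p - F q‖ ≤ χ * ‖p - q‖ := by simpa [dist_eq_norm] using hF.dist_le_mul p q
  have h2 : ‖C p - C q‖ ≤ μ * ‖p - q‖ := by simpa [dist_eq_norm] using hC.dist_le_mul p q
  refine (norm_sub_le _ _).trans ?_
  rw [add_mul, norm_smul, norm_inv, Real.norm_of_nonneg hγ0.le]
  refine add_le_add ?_ h2
  calc γ⁻¹ * ‖F p - F q‖ ≤ ε⁻¹ * (χ * ‖p - q‖) := by gcongr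
    _ = _ := by ring

theorem mem_of_mem_inv_add_smul {A : H → Set H} {p z : H} (hγ : 0 < γ)
    (hp : p ∈ inv (add (single F) (smul γ A)) z) : γ⁻¹ • (z - F p) ∈ A p := by
  obtain ⟨-, rfl, -, ⟨w, hw, rfl⟩, h⟩ := Set.mem_add.1 hp
  rwa [← h, add_sub_cancel_left, smul_smul, inv_mul_cancel₀ hγ.ne', one_smul]

end Kernel

/-- The operator acting coordinatewise on a finite Hilbert direct sum. -/
def diag {I : Type*} {Y : I → Type*} (A : ∀ i, Y i → Set (Y i)) : PiLp 2 Y → Set (PiLp 2 Y) :=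
  fun x => {u | ∀ i, u i ∈ A i (x i)}

theorem isMaximallyMonotone_diag {I : Type*} [Fintype I] {Y : I → Type*}
    [∀ i, NormedAddCommGroup (Y i)] [∀ i, InnerProductSpace ℝ (Y i)] [∀ i, CompleteSpace (Y i)]
    {A : ∀ i, Y i → Set (Y i)} (hA : ∀ i, IsMaximallyMonotone (A i)) :
    IsMaximallyMonotone (diag A) := by
  refine IsMonotone.isMaximallyMonotone ?_ fun z => ?_
  · intro x u y v hu hv
    rw [PiLp.inner_apply]
    exact Finset.sum_nonneg fun i _ => (hA i).1 (hu i) (hv i)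
  · choose p hp using fun i => (hA i).exists_resolvent one_pos (z i)
    refine ⟨WithLp.toLp 2 p, fun i => ?_⟩
    simpa using hp i

end SetValued

/-! ### Reduction of the coupled system to one composite inclusion. -/

namespace CoupledSystem

variable {I J : Type*} [Fintype I] {Y : I → Type*} {Z : J → Type*}
  [∀ i, NormedAddCommGroup (Y i)] [∀ i, InnerProductSpace ℝ (Y i)]
  [∀ j, NormedAddCommGroup (Z j)] [∀ j, InnerProductSpace ℝ (Z j)]

/-- The block operator `x ↦ (∑ i, L j i (x i))` between finite Hilbert direct sums. -/
noncomputable def blockMap (L : ∀ j i, Y i →L[ℝ] Z j) : PiLp 2 Y →L[ℝ] PiLp 2 Z :=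
  (PiLp.continuousLinearEquiv 2 ℝ Z).symm.toContinuousLinearMap ∘L
    (ContinuousLinearMap.pi fun j => ∑ i, L j i ∘L ContinuousLinearMap.proj i) ∘L
      (PiLp.continuousLinearEquiv 2 ℝ Y).toContinuousLinearMap

theorem blockMap_apply (L : ∀ j i, Y i →L[ℝ] Z j) (x : PiLp 2 Y) (j : J) :
    blockMap L x j = ∑ i, L j i (x i) := by
  simp [blockMap]

theorem adjoint_blockMap_apply [Fintype J] [∀ i, CompleteSpace (Y i)] [∀ j, CompleteSpace (Z j)]
    (L : ∀ j i, Y i →L[ℝ] Z j) (v : PiLp 2 Z) (i : I) :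
    ContinuousLinearMap.adjoint (blockMap L) v i
      = ∑ j, ContinuousLinearMap.adjoint (L j i) (v j) := by
  suffices ContinuousLinearMap.adjoint (blockMap L) v
      = WithLp.toLp 2 fun i => ∑ j, ContinuousLinearMap.adjoint (L j i) (v j) by rw [this]
  refine ext_inner_left ℝ fun x => ?_
  rw [ContinuousLinearMap.adjoint_inner_right]
  simp only [PiLp.inner_apply, blockMap_apply, sum_inner, inner_sum,
    ContinuousLinearMap.adjoint_inner_right]
  exact Finset.sum_comm

variable [Fintype J] [∀ i, CompleteSpace (Y i)] [∀ j, CompleteSpace (Z j)]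
  {A : ∀ i, Y i → Set (Y i)} {B : ∀ j, Z j → Set (Z j)} {C : ∀ i, Y i → Y i} {D : ∀ j, Z j → Z j}
  {L : ∀ j i, Y i →L[ℝ] Z j} {s : ∀ i, Y i} {r : ∀ j, Z j} {x : PiLp 2 Y} {v : PiLp 2 Z}

/-- The dual vector supplies the selections `v j` from `(B j + D j)`; their adjoint images cancel
the sum subtracted from `s i`. -/
theorem mem_primalSolutions_of_mem_kuhnTucker (h : (x, v) ∈ kuhnTucker A B C D L s r) :
    x ∈ primalSolutions A B C D L s r := by
  intro i
  obtain ⟨w, hw, -, rfl, h1⟩ := Set.mem_add.1 (h.1 i)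
  refine Set.mem_add.2 ⟨_, Set.add_mem_add hw (Set.finsetSum_mem_finsetSum Finset.univ _
    (fun j => ContinuousLinearMap.adjoint (L j i) (v j)) fun j _ => ⟨v j, h.2 j, rfl⟩), _, rfl, ?_⟩
  rw [add_right_comm, h1]
  simp

theorem mem_dualSolutions_of_mem_kuhnTucker (h : (x, v) ∈ kuhnTucker A B C D L s r) :
    v ∈ dualSolutions A B C D L s r :=
  ⟨x, h.1, h.2⟩

/-- The shift by `s` is placed to match the operator of `sub_const`. -/
theorem mem_kuhnTucker_iff : (x, v) ∈ kuhnTucker A B C D L s r ↔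
    -ContinuousLinearMap.adjoint (blockMap L) v + WithLp.toLp 2 s
      ∈ SetValued.diag (fun i => SetValued.add (A i) (SetValued.single (C i))) x ∧
    v ∈ SetValued.diag (fun j => SetValued.add (B j) (SetValued.single (D j)))
      (blockMap L x - WithLp.toLp 2 r) := by
  refine and_congr (forall_congr' fun i => ?_) (forall_congr' fun j => ?_)
  · rw [PiLp.add_apply, PiLp.neg_apply, adjoint_blockMap_apply, neg_add_eq_sub]
  · rw [PiLp.sub_apply, blockMap_apply]
    rfl

end CoupledSystem

/-! ### The convergence theorem. -/

theorem corollary5p4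
    {I J : Type*} [Fintype I] [Fintype J] {Y : I → Type*} {Z : J → Type*}
    [∀ i, NormedAddCommGroup (Y i)] [∀ i, InnerProductSpace ℝ (Y i)] [∀ i, CompleteSpace (Y i)]
    [∀ j, NormedAddCommGroup (Z j)] [∀ j, InnerProductSpace ℝ (Z j)] [∀ j, CompleteSpace (Z j)]
    -- the problem
    (A : ∀ i, Y i → Set (Y i)) (hA : ∀ i, SetValued.IsMaximallyMonotone (A i))
    (B : ∀ j, Z j → Set (Z j)) (hB : ∀ j, SetValued.IsMaximallyMonotone (B j))
    (C : ∀ i, Y i → Y i) (hC : ∀ i, SetValued.IsMonotone (SetValued.single (C i)))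
    (μ : I → ℝ≥0) (hμ : ∀ i, 0 < μ i) (hCμ : ∀ i, LipschitzWith (μ i) (C i))
    (D : ∀ j, Z j → Z j) (hD : ∀ j, SetValued.IsMonotone (SetValued.single (D j)))
    (ν : J → ℝ≥0) (hν : ∀ j, 0 < ν j) (hDν : ∀ j, LipschitzWith (ν j) (D j))
    (L : ∀ j i, Y i →L[ℝ] Z j) (s : ∀ i, Y i) (r : ∀ j, Z j)
    (hZ : (CoupledSystem.kuhnTucker A B C D L s r).Nonempty)
    -- constants, kernels and step sizes
    (α : I → ℝ) (hα : ∀ i, 0 < α i) (χ : I → ℝ≥0) (hχ : ∀ i, 0 < χ i)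
    (β : J → ℝ) (hβ : ∀ j, 0 < β j) (κ : J → ℝ≥0) (hκ : ∀ j, 0 < κ j)
    (ε : I → ℝ) (hε : ∀ i, ε i ∈ Set.Ioo 0 (α i / (μ i + 1)))
    (δ : J → ℝ) (hδ : ∀ j, δ j ∈ Set.Ioo 0 (β j / (ν j + 1)))
    (F : ∀ i, ℕ → Y i → Y i)
    (hFα : ∀ i n, SetValued.IsStronglyMonotone (α i) (SetValued.single (F i n)))
    (hFχ : ∀ i n, LipschitzWith (χ i) (F i n))
    (W : ∀ j, ℕ → Z j → Z j)
    (hWβ : ∀ j n, SetValued.IsStronglyMonotone (β j) (SetValued.single (W j n)))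
    (hWκ : ∀ j n, LipschitzWith (κ j) (W j n))
    (γ : I → ℕ → ℝ) (hγ : ∀ i n, γ i n ∈ Set.Icc (ε i) ((α i - ε i) / μ i))
    (τ : J → ℕ → ℝ) (hτ : ∀ j n, τ j n ∈ Set.Icc (δ j) ((β j - δ j) / ν j))
    (lam : ℕ → ℝ) (hlam : ∀ n, lam n ∈ Set.Ioo 0 2)
    (hlam_inf : 0 < ⨅ n, lam n) (hlam_sup : (⨆ n, lam n) < 2) :
    -- the inverse operators in the algorithm are everywhere defined and single-valued
    (∀ i n (z : Y i), ∃! p, p ∈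
      SetValued.inv (SetValued.add (SetValued.single (F i n)) (SetValued.smul (γ i n) (A i))) z) ∧
    (∀ j n (z : Z j), ∃! p, p ∈
      SetValued.inv (SetValued.add (SetValued.single (W j n)) (SetValued.smul (τ j n) (B j))) z) ∧
    -- every orbit of the algorithm: iterates, evaluation points, auxiliary sequences
    ∀ (x : ℕ → PiLp 2 Y) (y v : ℕ → PiLp 2 Z)
    (x' : ℕ → PiLp 2 Y) (y' v' : ℕ → PiLp 2 Z)
    (l a o aStar : ∀ i, ℕ → Y i) (t b f c bStar cStar : ∀ j, ℕ → Z j)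
    (σ θ ρ : ℕ → ℝ)
    -- the algorithm
    (hl : ∀ i n, l i n = F i n (x' n i) - γ i n • C i (x' n i)
      - γ i n • ∑ j, ContinuousLinearMap.adjoint (L j i) (v' n j))
    (ha : ∀ i n, a i n ∈
      SetValued.inv (SetValued.add (SetValued.single (F i n)) (SetValued.smul (γ i n) (A i)))
        (l i n + γ i n • s i))
    (ho : ∀ i n, o i n = (γ i n)⁻¹ • (l i n - F i n (a i n)) + C i (a i n))
    (ht : ∀ j n, t j n = W j n (y' n j) - τ j n • D j (y' n j) + τ j n • v' n j)
    (hb : ∀ j n, b j n ∈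
      SetValued.inv (SetValued.add (SetValued.single (W j n)) (SetValued.smul (τ j n) (B j)))
        (t j n))
    (hf : ∀ j n, f j n = (τ j n)⁻¹ • (t j n - W j n (b j n)) + D j (b j n))
    (hc : ∀ j n, c j n = ∑ i, L j i (x' n i) - y' n j + v' n j - r j)
    (haStar : ∀ i n, aStar i n
      = o i n + ∑ j, ContinuousLinearMap.adjoint (L j i) (c j n))
    (hbStar : ∀ j n, bStar j n = f j n - c j n)
    (hcStar : ∀ j n, cStar j n = r j + b j n - ∑ i, L j i (a i n))
    (hσ : ∀ n, σ n = ∑ i, ‖aStar i n‖ ^ 2 + ∑ j, (‖bStar j n‖ ^ 2 + ‖cStar j n‖ ^ 2))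
    (hθ : ∀ n, θ n = ∑ i, inner ℝ (a i n - x n i) (aStar i n)
      + ∑ j, (inner ℝ (b j n - y n j) (bStar j n) + inner ℝ (c j n - v n j) (cStar j n)))
    (hρ : ∀ n, ρ n = if θ n < 0 then lam n * θ n / σ n else 0)
    (hx : ∀ i n, x (n + 1) i = x n i + ρ n • aStar i n)
    (hy : ∀ j n, y (n + 1) j = y n j + ρ n • bStar j n)
    (hv : ∀ j n, v (n + 1) j = v n j + ρ n • cStar j n)
    -- the evaluation points approach the iterates
    (hx' : ∀ i, Filter.Tendsto (fun n => x' n i - x n i) Filter.atTop (nhds 0))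
    (hy' : ∀ j, Filter.Tendsto (fun n => y' n j - y n j) Filter.atTop (nhds 0))
    (hv' : ∀ j, Filter.Tendsto (fun n => v' n j - v n j) Filter.atTop (nhds 0)),
    ∃ (xbar : PiLp 2 Y) (vbar : PiLp 2 Z),
      WeaklyConverges x xbar ∧ xbar ∈ CoupledSystem.primalSolutions A B C D L s r ∧
      WeaklyConverges v vbar ∧ vbar ∈ CoupledSystem.dualSolutions A B C D L s r ∧
      (xbar, vbar) ∈ CoupledSystem.kuhnTucker A B C D L s r := by
  have hγ0 : ∀ i n, 0 < γ i n := fun i n => (hε i).1.trans_le (hγ i n).1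
  have hτ0 : ∀ j n, 0 < τ j n := fun j n => (hδ j).1.trans_le (hτ j n).1
  refine ⟨fun i n z => (hA i).existsUnique_warped_resolvent (hα i) (hFα i n) (hFχ i n) (hγ0 i n) z,
    fun j n z => (hB j).existsUnique_warped_resolvent (hβ j) (hWβ j n) (hWκ j n) (hτ0 j n) z, ?_⟩
  intro x y v x' y' v' l a o aStar t b f c bStar cStar σ θ ρ hl ha ho ht hb hf hc haStar hbStar
    hcStar hσ hθ hρ hx hy hv hx' hy' hv'
  let M := SetValued.diag fun i => SetValued.add (A i) (SetValued.single (C i))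
  let N := SetValued.diag fun j => SetValued.add (B j) (SetValued.single (D j))
  have hM : SetValued.IsMaximallyMonotone M :=
    SetValued.isMaximallyMonotone_diag fun i => (hA i).add_single (hC i) (hCμ i)
  have hN : SetValued.IsMaximallyMonotone N :=
    SetValued.isMaximallyMonotone_diag fun j => (hB j).add_single (hD j) (hDν j)
  -- Increments of the kernels `γ⁻¹F - C` and `τ⁻¹W - D` between evaluation points and resolvent
  -- points; finiteness of `I` and `J` makes their constants uniform.
  let g : ∀ i, ℕ → Y i := fun i n =>
    (γ i n)⁻¹ • (F i n (x' n i) - F i n (a i n)) - (C i (x' n i) - C i (a i n))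
  let h : ∀ j, ℕ → Z j := fun j n =>
    (τ j n)⁻¹ • (W j n (y' n j) - W j n (b j n)) - (D j (y' n j) - D j (b j n))
  obtain ⟨ζ₁, hζ₁, hζ₁'⟩ := exists_pos_forall_ge fun i => (χ i : ℝ) / ε i + μ i
  obtain ⟨ζ₂, hζ₂, hζ₂'⟩ := exists_pos_forall_ge fun j => (κ j : ℝ) / δ j + ν j
  obtain ⟨η₁, hη₁, hη₁'⟩ := exists_pos_forall_le (f := fun i => ε i * μ i / (α i - ε i)) fun i =>
    div_pos (mul_pos (hε i).1 (hμ i)) (SetValued.sub_pos_of_mem_Ioo_div (hα i) (hε i))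
  obtain ⟨η₂, hη₂, hη₂'⟩ := exists_pos_forall_le (f := fun j => δ j * ν j / (β j - δ j)) fun j =>
    div_pos (mul_pos (hδ j).1 (hν j)) (SetValued.sub_pos_of_mem_Ioo_div (hβ j) (hδ j))
  have hlam' : ∀ n, ⨅ n, lam n ≤ lam n ∧ lam n ≤ ⨆ n, lam n := fun n =>
    ⟨ciInf_le ⟨0, by rintro _ ⟨k, rfl⟩; exact (hlam k).1.le⟩ n,
      le_ciSup ⟨2, by rintro _ ⟨k, rfl⟩; exact (hlam k).2.le⟩ n⟩
  -- The resolvent is evaluated at `l + γ s`, which contributes exactly the `s i` absorbed by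
  -- `sub_const`.
  have haA : ∀ i n, (γ i n)⁻¹ • (l i n - F i n (a i n)) + s i ∈ A i (a i n) := fun i n => by
    convert SetValued.mem_of_mem_inv_add_smul (hγ0 i n) (ha i n) using 1
    rw [add_sub_right_comm, smul_add, smul_smul, inv_mul_cancel₀ (hγ0 i n).ne', one_smul]
  have hbB : ∀ j n, (τ j n)⁻¹ • (t j n - W j n (b j n)) ∈ B j (b j n) := fun j n =>
    SetValued.mem_of_mem_inv_add_smul (hτ0 j n) (hb j n)
  obtain ⟨⟨x₀, v₀⟩, hxv⟩ := hZ
  rw [CoupledSystem.mem_kuhnTucker_iff] at hxv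
  obtain ⟨xbar, vbar, h₁, h₂, h₃, h₄⟩ := SetValued.exists_weak_limit_of_projective_splitting
    (hM.sub_const (WithLp.toLp 2 s)) hN (CoupledSystem.blockMap L) (WithLp.toLp 2 r)
    ⟨x₀, v₀, hxv⟩ (x := x) (x' := x') (y := y) (y' := y') (v := v) (v' := v')
    (a := fun n => WithLp.toLp 2 fun i => a i n) (b := fun n => WithLp.toLp 2 fun j => b j n)
    (c := fun n => WithLp.toLp 2 fun j => c j n)
    (aStar := fun n => WithLp.toLp 2 fun i => aStar i n)
    (bStar := fun n => WithLp.toLp 2 fun j => bStar j n)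
    (cStar := fun n => WithLp.toLp 2 fun j => cStar j n)
    (g := fun n => WithLp.toLp 2 fun i => g i n) (h := fun n => WithLp.toLp 2 fun j => h j n)
    (lam := lam) (ρ := ρ) (θ := θ) (σ := σ)
    (ζ := max ζ₁ ζ₂) (η := min η₁ η₂) (lt_max_of_lt_left hζ₁) (lt_min hη₁ hη₂) hlam_inf hlam_sup
    hlam'
    (fun n => PiLp.norm_le_mul_of_forall (lt_max_of_lt_left hζ₁).le fun i =>
      (SetValued.norm_warped_kernel_le (hε i).1 (hγ i n).1 (hFχ i n) (hCμ i) _ _).trans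
        (mul_le_mul_of_nonneg_right ((hζ₁' i).trans (le_max_left _ _)) (norm_nonneg _)))
    (fun n => PiLp.mul_norm_sq_le_inner_of_forall fun i =>
      (mul_le_mul_of_nonneg_right ((min_le_left _ _).trans (hη₁' i)) (sq_nonneg _)).trans
        ((hFα i n).warped_kernel (hα i) (hμ i) (hε i) (hγ i n) (hCμ i) _ _))
    (fun n => PiLp.norm_le_mul_of_forall (lt_max_of_lt_left hζ₁).le fun j =>
      (SetValued.norm_warped_kernel_le (hδ j).1 (hτ j n).1 (hWκ j n) (hDν j) _ _).trans
        (mul_le_mul_of_nonneg_right ((hζ₂' j).trans (le_max_right _ _)) (norm_nonneg _)))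
    (fun n => PiLp.mul_norm_sq_le_inner_of_forall fun j =>
      (mul_le_mul_of_nonneg_right ((min_le_right _ _).trans (hη₂' j)) (sq_nonneg _)).trans
        ((hWβ j n).warped_kernel (hβ j) (hν j) (hδ j) (hτ j n) (hDν j) _ _))
    (fun n i => by
      refine Set.mem_add.2 ⟨_, haA i n, _, rfl, ?_⟩
      simp only [PiLp.add_apply, PiLp.sub_apply, CoupledSystem.adjoint_blockMap_apply, haStar, ho]
      abel)
    (fun n j => by
      refine Set.mem_add.2 ⟨_, hbB j n, _, rfl, ?_⟩
      simp only [PiLp.add_apply, hbStar, hf]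
      abel)
    (fun n => by
      ext i
      simp only [PiLp.sub_apply, map_sub, CoupledSystem.adjoint_blockMap_apply, haStar, ho, hl, g,
        smul_sub, smul_smul, inv_mul_cancel₀ (hγ0 i n).ne', one_smul]
      abel)
    (fun n => by
      ext j
      simp only [PiLp.sub_apply, PiLp.add_apply, hbStar, hf, ht, h,
        smul_sub, smul_add, smul_smul, inv_mul_cancel₀ (hτ0 j n).ne', one_smul]
      abel)
    (fun n => by
      ext j
      simp only [PiLp.sub_apply, PiLp.add_apply, CoupledSystem.blockMap_apply, hc])
    (fun n => by
      ext j
      simp only [PiLp.sub_apply, PiLp.add_apply, CoupledSystem.blockMap_apply, hcStar])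
    (fun n => by
      simp only [hσ, PiLp.norm_sq_eq_of_L2, Finset.sum_add_distrib])
    (fun n => by
      simp only [hθ, PiLp.inner_apply, PiLp.sub_apply, Finset.sum_add_distrib])
    hρ (fun n => by ext i; exact hx i n) (fun n => by ext j; exact hy j n)
    (fun n => by ext j; exact hv j n) (PiLp.tendsto_zero_of_forall hx')
    (PiLp.tendsto_zero_of_forall hy') (PiLp.tendsto_zero_of_forall hv')
  have hKT : (xbar, vbar) ∈ CoupledSystem.kuhnTucker A B C D L s r :=
    CoupledSystem.mem_kuhnTucker_iff.2 ⟨h₁, h₂⟩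
  exact ⟨xbar, vbar, weaklyConverges_of_forall_inner h₃,
    CoupledSystem.mem_primalSolutions_of_mem_kuhnTucker hKT, weaklyConverges_of_forall_inner h₄,
    CoupledSystem.mem_dualSolutions_of_mem_kuhnTucker hKT, hKT⟩
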